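/- **Setting.** Let $r,s\ge 1$ be integers, $I_{r,s}=\{1,\dots,r\}\times\{1,\dots,s\}$, and let $p$ be a probability mass function (p.m.f.) on $I_{r,s}$ with $p_{ij}>0$ for all $(i,j)$. Let $(X_1,Y_1),(X_2,Y_2),\dots$ be independent random vectors with p.m.f. $p$. Put $$\hat p^{[n]}_{ij}=\frac1n\sum_{k=1}^n \mathbf 1(X_k=i,Y_k=j),\qquad p^{[n]}_{ij}=\frac1{n+1}\Big\{\sum_{k=1}^n \mathbf 1(X_k=i,Y_k=j)+\frac1{rs}\Big\}.$$ For a strictly positive p.m.f. $x$ on $I_{r,s}$, let $\mathcal U(x)$ be the limit of the iterative proportional fitting procedure started at $x$ that alternately rescales the rows to have sums $1/r$ and the columns to have sums $1/s$ (rows first). Put $u=\mathcal U(p)$ and $u^{[n]}=\mathcal U(p^{[n]})$. A copula p.m.f. is a p.m.f. on $I_{r,s}$ with uniform margins. Let $\mathrm{vec}(y)=(y_{ij})_{(i,j)\in I_{r,s}}\in\mathbb R^{rs}$ be the column-major vectorization of $y\in\mathbb R^{r\times s}$. Let $\Theta\subset\mathbb R^m$ be open, and let $\{u^{[\theta]}:\theta\in\Theta\}$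 be a family of strictly positive copula p.m.f.s. Let $\hat\theta^{[n]}$ be an estimator, i.e. a $\Theta$-valued function of $(X_1,Y_1),\dots,(X_n,Y_n)$. Let $\dot u^{[\theta]}$ be the $rs\times m$ Jacobian matrix of $\theta\mapsto \mathrm{vec}(u^{[\theta]})$ (the row of a cell $(i,j)$ is taken to be zero at points $\theta$ where $\theta\mapsto u^{[\theta]}_{ij}$ is not differentiable). For $\theta\in\Theta$, $u'$ a strictly positive copula p.m.f. and $p'$ a strictly positive p.m.f. on $I_{r,s}$, let $V^{[\theta]}_{u',p'}$ be a given real $m\times rs$ matrix. Let $G$ be a grouping matrix: a $q\times rs$ matrix with entries in $\{0,1\}$, exactly one $1$ in each column and at least one $1$ in each row. Define $$S_G^{[n]}=n\,\big\|\mathrm{diag}(G\,\mathrm{vec}(u^{[\hat\theta^{[n]}]}))^{-1/2}\,G\,\mathrm{vec}(u^{[n]}-u^{[\hat\theta^{[n]}]})\big\|_2^2 .$$ Let $\Sigma_{p'}=\mathrm{diag}\{\mathrm{vec}(p')\}-\mathrm{vec}(p')\mathrm{vec}(p')^\top$ and $J_{u',p'}=-K L_{u'}^{-1}M_{p'}N$,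 where, with $k,i\in\{1,\dots,r-1\}$ and $l,j\in\{1,\dots,s-1\}$ in the definition of $L$: * $K\in\mathbb R^{rs\times(r-1)(s-1)}$ consists of $s\times(s-1)$ blocks of size $r\times(r-1)$: for $j<s$, the $j$-th block row has $H$ in block column $j$ and zeros elsewhere, and the last block row is $(-H,\dots,-H)$. Here $H\in\mathbb R^{r\times(r-1)}$ is the identity matrix followed by a last row of $-1$'s. * $L_{u'}$ has, at row $(k,l)$ and column $(i,j)$, the entry $$\frac{\mathbf 1(i=k,j=l)}{u'_{kl}}+\frac{\mathbf 1(j=l)}{s^{-1}-\sum_{g=1}^{r-1}u'_{gl}}+\frac{\mathbf 1(i=k)}{r^{-1}-\sum_{h=1}^{s-1}u'_{kh}}+\frac1{r^{-1}+s^{-1}-1+\sum_{g=1}^{r-1}\sum_{h=1}^{s-1}u'_{gh}} .$$ * $M_{p'}$ has, at row $(k,l)$ with $k<r$, $l<s$, and column $(i,j)\in I_{r,s}\setminus\{(r,s)\}$, the entry $$-\frac{\mathbf 1(i=k,j=l)}{p'_{kl}}+\frac{\mathbf 1(i=r,j=l)}{p'_{rl}}+\frac{\mathbf 1(i=k,j=s)}{p'_{ks}}+\frac1{1-\sum_{(g,h)\ne(r,s)}p'_{gh}}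 .$$ * $N\in\mathbb R^{(rs-1)\times rs}$ deletes the last coordinate (that of the cell $(r,s)$). (If $r=1$ or $s=1$, then $J_{u',p'}=0$.) Finally let $$\Sigma^{[\theta]}_{G,u',p'}=\mathrm{diag}(G\,\mathrm{vec}(u^{[\theta]}))^{-1/2}\,G\,(J_{u',p'}-\dot u^{[\theta]}V^{[\theta]}_{u',p'})\,\Sigma_{p'}\,(J_{u',p'}-\dot u^{[\theta]}V^{[\theta]}_{u',p'})^\top G^\top\,\mathrm{diag}(G\,\mathrm{vec}(u^{[\theta]}))^{-1/2}.$$ **Proposition 4.2.** Assume that $u=u^{[\theta_0]}$ for some $\theta_0\in\Theta$, that $\theta\mapsto u^{[\theta]}$ is differentiable at $\theta_0$, and that $$\sqrt n(\hat\theta^{[n]}-\theta_0)=V^{[\theta_0]}_{u,p}\,\sqrt n\,\mathrm{vec}(\hat p^{[n]}-p)+o_P(1).$$ Then, as $n\to\infty$, $S_G^{[n]}$ converges weakly in $\mathbb R$ to $\sum_{k=1}^q\lambda_kZ_k^2$, where $Z_1,\dots,Z_q$ are i.i.d. $N(0,1)$ and $\lambda_1,\dots,\lambda_q$ are the eigenvalues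 (with multiplicity) of the symmetric matrix $\Sigma^{[\theta_0]}_{G,u,p}$. If, moreover, the map $(\theta,u',p')\mapsto\Sigma^{[\theta]}_{G,u',p'}$ (on $\Theta$ times the strictly positive copula p.m.f.s times the strictly positive p.m.f.s) is continuous at $(\theta_0,u,p)$, then $\Sigma^{[\hat\theta^{[n]}]}_{G,u^{[n]},p^{[n]}}\to\Sigma^{[\theta_0]}_{G,u,p}$ in probability in $\mathbb R^{q\times q}$. -/

import Mathlib

open MeasureTheory ProbabilityTheory Filter Topology

namespace CopulaGOF

/-! Bivariate tables have `r = R + 1` rows and `s = S + 1` columns, where `R S : ℕ` are arbitrary, so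
that `r` and `s` are arbitrary strictly positive integers. The last row index is `Fin.last R`, and
the first `r - 1` row indices are the `Fin.castSucc k` with `k : Fin R`; likewise for columns. -/

/-- Real `r × s` matrices. -/
abbrev Table (R S : ℕ) : Type := Matrix (Fin (R + 1)) (Fin (S + 1)) ℝ

/-- The cells `(i, j)` of an `r × s` table. Vectors of dimension `rs` are indexed by cells, so that no
enumeration of the cells has to be chosen. -/
abbrev Cell (R S : ℕ) : Type := Fin (R + 1) × Fin (S + 1)

/-- The cells `(k, l)` with `k < r` and `l < s`. -/
abbrev InnerCell (R S : ℕ) : Type := Fin R × Fin S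

/-- The cells other than the last one `(r, s)`. -/
abbrev NonLastCell (R S : ℕ) : Type := {c : Cell R S // c ≠ (Fin.last R, Fin.last S)}

/-- Bivariate probability mass functions with support equal to the set of all cells. -/
def posPmf (R S : ℕ) : Set (Table R S) :=
  {x | (∀ i j, 0 < x i j) ∧ ∑ i, ∑ j, x i j = 1}

/-- Copula p.m.f.s (bivariate p.m.f.s with uniform margins) whose support is the set of all cells. -/
def posCopulaPmf (R S : ℕ) : Set (Table R S) :=
  {x | x ∈ posPmf R S ∧ (∀ i, ∑ j, x i j = ((R : ℝ) + 1)⁻¹) ∧ (∀ j, ∑ i, x i j = ((S : ℝ) + 1)⁻¹)}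

noncomputable section

/-! ### The iterative proportional fitting procedure -/

/-- Rescale the rows of `x` so that the row sums become `a`. -/
def rowScale {R S : ℕ} (a : Fin (R + 1) → ℝ) (x : Table R S) : Table R S :=
  Matrix.of fun i j => a i * x i j / ∑ j', x i j'

/-- Rescale the columns of `x` so that the column sums become `b`. -/
def colScale {R S : ℕ} (b : Fin (S + 1) → ℝ) (x : Table R S) : Table R S :=
  Matrix.of fun i j => b j * x i j / ∑ i', x i' j

/-- The table obtained after `N` steps of the procedure started at `x`, with target margins `a` and
`b`: rows and columns are rescaled alternately, beginning with the rows. -/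
def ipfpStep {R S : ℕ} (a : Fin (R + 1) → ℝ) (b : Fin (S + 1) → ℝ) (N : ℕ) (x : Table R S) :
    Table R S :=
  if Even N then (colScale b ∘ rowScale a)^[N / 2] x
  else rowScale a ((colScale b ∘ rowScale a)^[N / 2] x)

/-- The limit of the procedure with target margins `a` and `b`. -/
def ipfp {R S : ℕ} (a : Fin (R + 1) → ℝ) (b : Fin (S + 1) → ℝ) (x : Table R S) : Table R S :=
  limUnder atTop fun N => ipfpStep a b N x

/-- The map `𝒰`: the procedure with uniform target margins. -/
def ipfpUnif {R S : ℕ} (x : Table R S) : Table R S :=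
  ipfp (fun _ => ((R : ℝ) + 1)⁻¹) (fun _ => ((S : ℝ) + 1)⁻¹) x

/-! ### Empirical quantities computed from a sample `x` of size `n` -/

/-- The empirical p.m.f. `p̂ⁿ`. -/
def empPmf {R S n : ℕ} (x : Fin n → Cell R S) : Table R S :=
  Matrix.of fun i j => (1 / (n : ℝ)) * ∑ k, if x k = (i, j) then 1 else 0

/-- The smoothed empirical p.m.f. `pⁿ`. -/
def smoothPmf {R S n : ℕ} (x : Fin n → Cell R S) : Table R S :=
  Matrix.of fun i j => (1 / ((n : ℝ) + 1)) *
    ((∑ k, if x k = (i, j) then 1 else 0) + 1 / (((R : ℝ) + 1) * ((S : ℝ) + 1)))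

/-- The empirical copula p.m.f. `uⁿ = 𝒰(pⁿ)`. -/
def empCopula {R S n : ℕ} (x : Fin n → Cell R S) : Table R S := ipfpUnif (smoothPmf x)

/-! ### The matrices entering the limiting covariance matrix -/

/-- Vectorization. -/
def vec {R S : ℕ} (y : Table R S) : Cell R S → ℝ := fun c => y c.1 c.2

/-- The `(n + 1) × n` matrix whose first `n` rows form the identity matrix and whose last row is
constant equal to `-1`. -/
def matH (n : ℕ) : Matrix (Fin (n + 1)) (Fin n) ℝ :=
  Matrix.of fun i k => if i = k.castSucc then 1 else if i = Fin.last n then -1 else 0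

/-- The `rs × (r-1)(s-1)` matrix `K`. For `j < s` its `j`-th block row has the block `H` in block
column `j` and zeros elsewhere; its last block row is `(-H, …, -H)`. -/
def matK (R S : ℕ) : Matrix (Cell R S) (InnerCell R S) ℝ :=
  Matrix.of fun c d =>
    if c.2 = d.2.castSucc then matH R c.1 d.1
    else if c.2 = Fin.last S then -matH R c.1 d.1 else 0

/-- The `(r-1)(s-1) × (r-1)(s-1)` matrix `L_u`; the row index is `(k, l) = d`, the column index is
`(i, j) = e`. -/
def matL {R S : ℕ} (u : Table R S) : Matrix (InnerCell R S) (InnerCell R S) ℝ :=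
  Matrix.of fun d e =>
    (if e.1 = d.1 ∧ e.2 = d.2 then 1 else 0) / u d.1.castSucc d.2.castSucc
    + (if e.2 = d.2 then 1 else 0) /
        (((S : ℝ) + 1)⁻¹ - ∑ g : Fin R, u g.castSucc d.2.castSucc)
    + (if e.1 = d.1 then 1 else 0) /
        (((R : ℝ) + 1)⁻¹ - ∑ h : Fin S, u d.1.castSucc h.castSucc)
    + 1 / (((R : ℝ) + 1)⁻¹ + ((S : ℝ) + 1)⁻¹ - 1
        + ∑ g : Fin R, ∑ h : Fin S, u g.castSucc h.castSucc)

/-- The `(r-1)(s-1) × (rs-1)` matrix `M_p`; the row index is `(k, l) = d`, the column index is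
`(i, j) = c`. -/
def matM {R S : ℕ} (p : Table R S) : Matrix (InnerCell R S) (NonLastCell R S) ℝ :=
  Matrix.of fun d c =>
    -((if c.1.1 = d.1.castSucc ∧ c.1.2 = d.2.castSucc then 1 else 0)
        / p d.1.castSucc d.2.castSucc)
    + (if c.1.1 = Fin.last R ∧ c.1.2 = d.2.castSucc then 1 else 0)
        / p (Fin.last R) d.2.castSucc
    + (if c.1.1 = d.1.castSucc ∧ c.1.2 = Fin.last S then 1 else 0)
        / p d.1.castSucc (Fin.last S)
    + 1 / (1 - ∑ g : NonLastCell R S, p g.1.1 g.1.2)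

/-- The `(rs-1) × rs` matrix `N` that deletes the last coordinate. -/
def matN (R S : ℕ) : Matrix (NonLastCell R S) (Cell R S) ℝ :=
  Matrix.of fun c c' => if c.1 = c' then 1 else 0

/-- `J_{u,p} = -K L_u⁻¹ M_p N`. -/
def matJ {R S : ℕ} (u p : Table R S) : Matrix (Cell R S) (Cell R S) ℝ :=
  -(matK R S * (matL u)⁻¹ * matM p * matN R S)

/-- The multinomial covariance matrix `Σ_p = diag(vec p) - vec p (vec p)ᵀ`. -/
def multinomialCov {R S : ℕ} (p : Table R S) : Matrix (Cell R S) (Cell R S) ℝ :=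
  Matrix.diagonal (vec p) - Matrix.vecMulVec (vec p) (vec p)

/-- The `rs × m` Jacobian matrix at `θ` of `θ ↦ vec u^θ`. -/
def jacobian {R S m : ℕ} (u : EuclideanSpace ℝ (Fin m) → Table R S)
    (θ : EuclideanSpace ℝ (Fin m)) : Matrix (Cell R S) (Fin m) ℝ :=
  Matrix.of fun c k => fderiv ℝ (fun t => u t c.1 c.2) θ (EuclideanSpace.single k 1)

/-- Grouping matrices: `q × rs` matrices with entries in `{0, 1}`, exactly one `1` in each column (so
`rs` in total) and at least one `1` in each row (each row sums one or more cells). -/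
structure IsGroupingMatrix {R S q : ℕ} (G : Matrix (Fin q) (Cell R S) ℝ) : Prop where
  zero_or_one : ∀ a c, G a c = 0 ∨ G a c = 1
  column : ∀ c, ∃! a, G a c = 1
  row : ∀ a, ∃ c, G a c = 1

/-- `diag(G vec u)^{-1/2}`. -/
def invSqrtDiag {R S q : ℕ} (G : Matrix (Fin q) (Cell R S) ℝ) (u : Table R S) :
    Matrix (Fin q) (Fin q) ℝ :=
  Matrix.diagonal fun a => (√((G.mulVec (vec u)) a))⁻¹

/-- The covariance matrix `Σ_{G,v,p}^θ` for the parametric family `u` and the `m × rs` matrix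
`V_{v,p}^θ = V θ v p`. -/
def limitCov {R S m q : ℕ} (G : Matrix (Fin q) (Cell R S) ℝ)
    (u : EuclideanSpace ℝ (Fin m) → Table R S)
    (V : EuclideanSpace ℝ (Fin m) → Table R S → Table R S → Matrix (Fin m) (Cell R S) ℝ)
    (θ : EuclideanSpace ℝ (Fin m)) (v p : Table R S) : Matrix (Fin q) (Fin q) ℝ :=
  invSqrtDiag G (u θ) * G * (matJ v p - jacobian u θ * V θ v p) * multinomialCov p
    * (matJ v p - jacobian u θ * V θ v p).transpose * G.transpose * invSqrtDiag G (u θ)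

/-- The covariance matrix is symmetric, so that its eigenvalues (repeated according to multiplicity)
are available as `(limitCov_isHermitian G u V θ v p).eigenvalues : Fin q → ℝ`. -/
theorem limitCov_isHermitian {R S m q : ℕ} (G : Matrix (Fin q) (Cell R S) ℝ)
    (u : EuclideanSpace ℝ (Fin m) → Table R S)
    (V : EuclideanSpace ℝ (Fin m) → Table R S → Table R S → Matrix (Fin m) (Cell R S) ℝ)
    (θ : EuclideanSpace ℝ (Fin m)) (v p : Table R S) :
    (limitCov G u V θ v p).IsHermitian := by
  have h1 : (multinomialCov p).transpose = multinomialCov p := by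
    simp [multinomialCov, Matrix.transpose_vecMulVec]
  have h2 : (invSqrtDiag G (u θ)).transpose = invSqrtDiag G (u θ) := by
    simp [invSqrtDiag]
  unfold Matrix.IsHermitian
  rw [Matrix.conjTranspose_eq_transpose_of_trivial]
  simp only [limitCov, Matrix.transpose_mul, Matrix.transpose_transpose, h1, h2, Matrix.mul_assoc]

/-- The grouped chi-square statistic
`S_Gⁿ = n ‖diag(G vec v)^{-1/2} G vec(uⁿ - v)‖₂²` computed from the sample `x` of size `n`, where `v`
is the fitted copula p.m.f. -/
def chiSquareStat {R S n q : ℕ} (G : Matrix (Fin q) (Cell R S) ℝ) (x : Fin n → Cell R S)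
    (v : Table R S) : ℝ :=
  (n : ℝ) * ‖WithLp.toLp 2
    ((invSqrtDiag G v).mulVec (G.mulVec (vec (empCopula x - v))))‖ ^ 2

/-- The sample formed by the first `n` observations. -/
def sample {Ω : Type*} {R S : ℕ} (XY : ℕ → Ω → Cell R S) (n : ℕ) (ω : Ω) : Fin n → Cell R S :=
  fun k => XY k ω

end

end CopulaGOF

open CopulaGOF

/-! The limit `𝒰(x)` is the unique strictly positive copula p.m.f. with the same log odds ratios `Kᵀ
log x` as `x`. Uniqueness: the difference of two copula p.m.f.s has zero margins, hence lies in the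
range of `K` and is orthogonal to the difference of their logarithms as soon as the odds ratios
agree; monotonicity of `log` then forces equality (`eq_of_logOdds_eq`). Existence: each rescaling
preserves the odds ratios and increases the sum of the logarithms of the entries, so the iterates
stay in a compact set of positive tables and every cluster point is a fixed point with uniform
margins (`exists_tendsto_ultrafilter`).

Near `u = 𝒰(p)`, copula p.m.f.s are `u + K d`, so `𝒰(x)` solves `Kᵀ log(u + K d) = Kᵀ log x`. The
derivative in `d` at `0` is `Kᵀ diag(1/u) K = L_u`, which is positive definite. The inverse function
theorem gives the derivative `K L_u⁻¹ Kᵀ diag(1/p)`, which agrees with `J_{u,p}` on vectors of total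
mass zero (`exists_hasFDerivWithinAt_ipfpUnif`).

The delta method, applied to `𝒰` and to the parametric family, gives `√n vec(uⁿ - u^θ̂) = (J - u̇ V)
√n vec(p̂ⁿ - p) + o_P(1)` (`tendsto_empCopula_sub_family`). After normalization and rotation by an
orthogonal matrix diagonalizing the limiting covariance, which leaves the Euclidean norm unchanged,
the central limit theorem and Slutsky's lemma yield independent limits `√λ_k Z_k`; squaring the norm
gives the claim. Consistency of the plug-in covariance is continuous mapping. -/

namespace CopulaGOF

/-! ### The matrix `K` -/

/-- `K` is a Kronecker product of two copies of `H`, so its properties reduce to the one-dimensional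
contrasts encoded by `H`. -/
theorem matK_apply {R S : ℕ} (c : Cell R S) (d : InnerCell R S) :
    matK R S c d = matH R c.1 d.1 * matH S c.2 d.2 := by
  simp only [matK, matH, Matrix.of_apply]
  by_cases h : c.2 = d.2.castSucc
  · simp [h]
  · by_cases h' : c.2 = Fin.last S <;> simp [h, h']

@[simp] theorem matH_castSucc (n : ℕ) (i k : Fin n) :
    matH n i.castSucc k = if i = k then 1 else 0 := by
  simp [matH, (Fin.castSucc_lt_last i).ne]

@[simp] theorem matH_last (n : ℕ) (k : Fin n) : matH n (Fin.last n) k = -1 := by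
  simp [matH, (Fin.castSucc_lt_last k).ne']

theorem sum_matH_mul (n : ℕ) (k : Fin n) (f : Fin (n + 1) → ℝ) :
    ∑ i, matH n i k * f i = f k.castSucc - f (Fin.last n) := by
  simp [Fin.sum_univ_castSucc, sub_eq_add_neg]

theorem sum_matH (n : ℕ) (k : Fin n) : ∑ i, matH n i k = 0 := by
  simpa using sum_matH_mul n k (fun _ => 1)

/-- Applied to the logarithms of a table, these double differences are the log odds ratios relative
to the last row and column. -/
theorem matK_transpose_mulVec {R S : ℕ} (y : Cell R S → ℝ) (d : InnerCell R S) :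
    ((matK R S).transpose.mulVec y) d =
      y (d.1.castSucc, d.2.castSucc) - y (Fin.last R, d.2.castSucc)
        - y (d.1.castSucc, Fin.last S) + y (Fin.last R, Fin.last S) := by
  have h : ((matK R S).transpose.mulVec y) d =
      ∑ i, matH R i d.1 * ∑ j, matH S j d.2 * y (i, j) := by
    simp only [Matrix.mulVec, dotProduct, Matrix.transpose_apply, matK_apply,
      Fintype.sum_prod_type, Finset.mul_sum, mul_assoc]
  rw [h]
  simp only [sum_matH_mul]
  ring

theorem matK_mulVec {R S : ℕ} (d : InnerCell R S → ℝ) (c : Cell R S) :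
    ((matK R S).mulVec d) c = ∑ k, matH R c.1 k * ∑ l, matH S c.2 l * d (k, l) := by
  simp only [Matrix.mulVec, dotProduct, matK_apply, Fintype.sum_prod_type, Finset.mul_sum,
    mul_assoc]

theorem sum_snd_matK_mulVec {R S : ℕ} (d : InnerCell R S → ℝ) (i : Fin (R + 1)) :
    ∑ j, ((matK R S).mulVec d) (i, j) = 0 := by
  simp only [Matrix.mulVec, dotProduct, matK_apply]
  rw [Finset.sum_comm]
  refine Finset.sum_eq_zero fun e _ => ?_
  rw [← Finset.sum_mul, ← Finset.mul_sum, sum_matH]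
  simp

theorem sum_fst_matK_mulVec {R S : ℕ} (d : InnerCell R S → ℝ) (j : Fin (S + 1)) :
    ∑ i, ((matK R S).mulVec d) (i, j) = 0 := by
  simp only [Matrix.mulVec, dotProduct, matK_apply]
  rw [Finset.sum_comm]
  refine Finset.sum_eq_zero fun e _ => ?_
  rw [← Finset.sum_mul, ← Finset.sum_mul, sum_matH]
  simp

theorem matK_mulVec_castSucc {R S : ℕ} (d : InnerCell R S → ℝ) (k : Fin R) (l : Fin S) :
    ((matK R S).mulVec d) (k.castSucc, l.castSucc) = d (k, l) := by
  simp [matK_mulVec]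

/-- A table with vanishing margins is determined by its inner cells. -/
theorem matK_mulVec_restrict {R S : ℕ} (h : Cell R S → ℝ) (hr : ∀ i, ∑ j, h (i, j) = 0)
    (hc : ∀ j, ∑ i, h (i, j) = 0) :
    (matK R S).mulVec (fun d => h (d.1.castSucc, d.2.castSucc)) = h := by
  have hr' : ∀ i, ∑ l : Fin S, h (i, l.castSucc) = -h (i, Fin.last S) := fun i => by
    have := hr i
    rw [Fin.sum_univ_castSucc] at this
    linarith
  have hc' : ∀ j, ∑ k : Fin R, h (k.castSucc, j) = -h (Fin.last R, j) := fun j => by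
    have := hc j
    rw [Fin.sum_univ_castSucc] at this
    linarith
  ext ⟨i, j⟩
  rw [matK_mulVec]
  refine Fin.lastCases ?_ (fun k => ?_) i <;> refine Fin.lastCases ?_ (fun l => ?_) j
  · simp [hr', hc']
  · simp [hc']
  · simp [hr']
  · simp

/-- Uniform margins turn the three denominators of `L_u` into the entries of `u` in the last row, in
the last column and at the last cell, which exposes `L_u` as a Gram matrix. -/
theorem matL_eq {R S : ℕ} {u : Table R S} (hu : u ∈ posCopulaPmf R S) :
    matL u = (matK R S).transpose * Matrix.diagonal (fun c => (vec u c)⁻¹) * matK R S := by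
  obtain ⟨-, hr, hc⟩ := hu
  have h1 : ∀ l : Fin S, ((S : ℝ) + 1)⁻¹ - ∑ g : Fin R, u g.castSucc l.castSucc
      = u (Fin.last R) l.castSucc := fun l => by
    rw [← hc l.castSucc, Fin.sum_univ_castSucc]; ring
  have h2 : ∀ k : Fin R, ((R : ℝ) + 1)⁻¹ - ∑ h : Fin S, u k.castSucc h.castSucc
      = u k.castSucc (Fin.last S) := fun k => by
    rw [← hr k.castSucc, Fin.sum_univ_castSucc]; ring
  have h3 : ((R : ℝ) + 1)⁻¹ + ((S : ℝ) + 1)⁻¹ - 1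
      + ∑ g : Fin R, ∑ h : Fin S, u g.castSucc h.castSucc = u (Fin.last R) (Fin.last S) := by
    have e1 : ∑ g : Fin R, ∑ h : Fin S, u g.castSucc h.castSucc
        = R * ((R : ℝ) + 1)⁻¹ - ∑ k : Fin R, u k.castSucc (Fin.last S) := by
      simp_rw [← h2]
      simp
    have e2 := hc (Fin.last S)
    rw [Fin.sum_univ_castSucc] at e2
    have e3 : (R : ℝ) * ((R : ℝ) + 1)⁻¹ = 1 - ((R : ℝ) + 1)⁻¹ := by
      have : (R : ℝ) + 1 ≠ 0 := by positivity
      field_simp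
      ring
    rw [e1, e3]
    linarith
  ext d e
  have h4 : ((matK R S).transpose * Matrix.diagonal (fun c => (vec u c)⁻¹) * matK R S) d e
      = ((matK R S).transpose.mulVec fun c => (vec u c)⁻¹ * matK R S c e) d := by
    rw [Matrix.mul_assoc]
    simp [Matrix.mul_apply, Matrix.mulVec, dotProduct, Matrix.diagonal_apply]
  rw [h4, matK_transpose_mulVec]
  simp only [matL, Matrix.of_apply, h1, h2, h3, matK_apply, matH_castSucc, matH_last, vec]
  have c1 : (e.1 = d.1) = (d.1 = e.1) := propext eq_comm
  have c2 : (e.2 = d.2) = (d.2 = e.2) := propext eq_comm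
  simp only [c1, c2]
  by_cases a : d.1 = e.1 <;> by_cases b : d.2 = e.2 <;> simp [a, b]

/-- The quadratic form of `L_u` at `x` is the sum of `(K x)_c² / u_c`, and `K` is injective because
the inner cells of `K x` are the coordinates of `x`. -/
theorem isUnit_matL {R S : ℕ} {u : Table R S} (hu : u ∈ posCopulaPmf R S) : IsUnit (matL u) := by
  rw [← Matrix.mulVec_injective_iff_isUnit]
  rw [show (matL u).mulVec = (matL u).mulVecLin from rfl, ← LinearMap.ker_eq_bot,
    LinearMap.ker_eq_bot']
  intro x hx
  rw [Matrix.mulVecLin_apply, matL_eq hu] at hx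
  have h1 : ∑ c, (vec u c)⁻¹ * ((matK R S).mulVec x c) ^ 2 = 0 := by
    have : x ⬝ᵥ (((matK R S).transpose * Matrix.diagonal (fun c => (vec u c)⁻¹)
        * matK R S).mulVec x) = 0 := by rw [hx]; simp
    rw [← Matrix.mulVec_mulVec, ← Matrix.mulVec_mulVec, Matrix.dotProduct_mulVec,
      Matrix.vecMul_transpose] at this
    rw [← this]
    simp only [dotProduct, Matrix.mulVec_diagonal]
    exact Finset.sum_congr rfl fun c _ => by ring
  have h2 : ∀ c, (matK R S).mulVec x c = 0 := fun c => by
    have hpos : ∀ c, 0 < (vec u c)⁻¹ := fun c => inv_pos.2 (hu.1.1 _ _)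
    have := (Finset.sum_eq_zero_iff_of_nonneg
      (fun c _ => mul_nonneg (hpos c).le (sq_nonneg _))).1 h1 c (Finset.mem_univ _)
    simpa [(hpos c).ne'] using this
  ext ⟨k, l⟩
  rw [← matK_mulVec_castSucc x k l, h2]
  rfl

/-- The constant term `1 / p_rs` of `M_p` multiplies the sum of `h` over all cells but the last,
which is `-h_rs` when the total is zero. -/
theorem matM_mul_matN_mulVec {R S : ℕ} {p : Table R S} (hp : p ∈ posPmf R S) (h : Cell R S → ℝ)
    (hh : ∑ c, h c = 0) :
    (matM p * matN R S).mulVec h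
      = -((matK R S).transpose.mulVec fun c => (vec p c)⁻¹ * h c) := by
  have hN : ∀ c, ((matN R S).mulVec h) c = h c.1 := fun c => by
    simp [matN, Matrix.mulVec, dotProduct]
  have hsplit : ∀ f : Cell R S → ℝ, ∑ c : NonLastCell R S, f c.1
      = ∑ c, f c - f (Fin.last R, Fin.last S) := fun f => by
    rw [← Finset.sum_erase_eq_sub (Finset.mem_univ _), eq_comm]
    exact Finset.sum_subtype _ (by simp) f
  have hplast : 1 - ∑ g : NonLastCell R S, p g.1.1 g.1.2 = p (Fin.last R) (Fin.last S) := by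
    rw [hsplit (fun c => p c.1 c.2), Fintype.sum_prod_type, hp.2]
    ring
  ext d
  rw [← Matrix.mulVec_mulVec, Pi.neg_apply, matK_transpose_mulVec]
  simp only [Matrix.mulVec, dotProduct] at hN ⊢
  simp only [hN, matM, Matrix.of_apply, hplast]
  rw [hsplit (fun c => (-((if c.1 = d.1.castSucc ∧ c.2 = d.2.castSucc then 1 else 0)
        / p d.1.castSucc d.2.castSucc)
    + (if c.1 = Fin.last R ∧ c.2 = d.2.castSucc then 1 else 0)
        / p (Fin.last R) d.2.castSucc
    + (if c.1 = d.1.castSucc ∧ c.2 = Fin.last S then 1 else 0)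
        / p d.1.castSucc (Fin.last S)
    + 1 / p (Fin.last R) (Fin.last S)) * h c)]
  simp only [add_mul, Finset.sum_add_distrib, ← Finset.mul_sum, hh]
  have hi : ∀ (i : Fin (R + 1)) (j : Fin (S + 1)) (a : ℝ),
      ∑ c : Cell R S, (if c.1 = i ∧ c.2 = j then 1 else 0) / a * h c = a⁻¹ * h (i, j) := by
    intro i j a
    rw [Finset.sum_eq_single (i, j)]
    · simp
    · rintro ⟨i', j'⟩ _ hne
      have : ¬(i' = i ∧ j' = j) := fun h => hne (by rw [h.1, h.2])
      simp [this]
    · simp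
  simp only [neg_mul, Finset.sum_neg_distrib, hi]
  simp [(Fin.castSucc_lt_last _).ne', vec]
  ring

/-! ### Convergence of the iterative proportional fitting procedure -/

/-- The log odds ratios `log (x_kl x_rs / (x_rl x_ks))` of a table. -/
noncomputable def logOdds {R S : ℕ} (x : Table R S) : InnerCell R S → ℝ :=
  (matK R S).transpose.mulVec fun c => Real.log (x c.1 c.2)

/-- The sum of the logarithms of the entries of a table. -/
noncomputable def sumLog {R S : ℕ} (x : Table R S) : ℝ := ∑ i, ∑ j, Real.log (x i j)

/-- Row and column effects cancel in double differences; this is why rescaling leaves the odds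
ratios unchanged. -/
theorem logOdds_congr_of_add {R S : ℕ} {x y : Table R S} {a : Fin (R + 1) → ℝ}
    {b : Fin (S + 1) → ℝ} (h : ∀ i j, Real.log (y i j) = Real.log (x i j) + a i + b j) :
    logOdds y = logOdds x := by
  ext d
  simp only [logOdds, matK_transpose_mulVec, h]
  ring

/-- A copula p.m.f. with full support is determined by its log odds ratios. -/
theorem eq_of_logOdds_eq {R S : ℕ} {v w : Table R S} (hv : v ∈ posCopulaPmf R S)
    (hw : w ∈ posCopulaPmf R S) (h : logOdds v = logOdds w) : v = w := by
  obtain ⟨⟨hv0, -⟩, hvr, hvc⟩ := hv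
  obtain ⟨⟨hw0, -⟩, hwr, hwc⟩ := hw
  set δ : Cell R S → ℝ := fun c => v c.1 c.2 - w c.1 c.2 with hδ
  have hK := matK_mulVec_restrict δ (fun i => by simp [hδ, hvr, hwr])
    (fun j => by simp [hδ, hvc, hwc])
  -- Since `δ` lies in the range of `K`, the pairing moves to `Kᵀ (log v - log w)`, which vanishes
  -- by hypothesis. Each summand is nonnegative because `log` is increasing, so each is zero.
  have h0 : ∑ c, δ c * (Real.log (v c.1 c.2) - Real.log (w c.1 c.2)) = 0 := by
    change δ ⬝ᵥ (fun c : Cell R S => Real.log (v c.1 c.2) - Real.log (w c.1 c.2)) = 0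
    rw [← hK, dotProduct_comm, Matrix.dotProduct_mulVec, ← Matrix.mulVec_transpose]
    have : (fun c : Cell R S => Real.log (v c.1 c.2) - Real.log (w c.1 c.2))
        = (fun c => Real.log (v c.1 c.2)) - fun c => Real.log (w c.1 c.2) := rfl
    rw [this, Matrix.mulVec_sub]
    change (logOdds v - logOdds w) ⬝ᵥ _ = 0
    simp [h]
  have hnn : ∀ c ∈ (Finset.univ : Finset (Cell R S)),
      0 ≤ δ c * (Real.log (v c.1 c.2) - Real.log (w c.1 c.2)) := by
    intro c _
    rcases le_total (v c.1 c.2) (w c.1 c.2) with hle | hle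
    · exact mul_nonneg_of_nonpos_of_nonpos (sub_nonpos.2 hle)
        (sub_nonpos.2 (Real.log_le_log (hv0 _ _) hle))
    · exact mul_nonneg (sub_nonneg.2 hle) (sub_nonneg.2 (Real.log_le_log (hw0 _ _) hle))
  ext i j
  have := (Finset.sum_eq_zero_iff_of_nonneg hnn).1 h0 (i, j) (Finset.mem_univ _)
  rcases mul_eq_zero.1 this with h1 | h1
  · exact sub_eq_zero.1 h1
  · exact Real.log_injOn_pos (hv0 i j) (hw0 i j) (sub_eq_zero.1 h1)

/-! ### Effect of one rescaling on the sum of logarithms and on the odds ratios. -/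

theorem rowSum_pos {R S : ℕ} {x : Table R S} (hx : ∀ i j, 0 < x i j) (i : Fin (R + 1)) :
    0 < ∑ j, x i j := Finset.sum_pos (fun j _ => hx i j) Finset.univ_nonempty

theorem log_rowScale {R S : ℕ} {a : Fin (R + 1) → ℝ} (ha : ∀ i, 0 < a i) {x : Table R S}
    (hx : ∀ i j, 0 < x i j) (i : Fin (R + 1)) (j : Fin (S + 1)) :
    Real.log (rowScale a x i j)
      = Real.log (x i j) + (Real.log (a i) - Real.log (∑ j, x i j)) := by
  rw [rowScale, Matrix.of_apply, Real.log_div (mul_pos (ha i) (hx i j)).ne' (rowSum_pos hx i).ne',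
    Real.log_mul (ha i).ne' (hx i j).ne']
  ring

theorem sum_rowScale {R S : ℕ} (a : Fin (R + 1) → ℝ) {x : Table R S}
    (hx : ∀ i j, 0 < x i j) (i : Fin (R + 1)) : ∑ j, rowScale a x i j = a i := by
  simp only [rowScale, Matrix.of_apply]
  rw [← Finset.sum_div, ← Finset.mul_sum, mul_div_assoc, div_self (rowSum_pos hx i).ne', mul_one]

theorem rowScale_mem_posPmf {R S : ℕ} {x : Table R S} (hx : x ∈ posPmf R S) :
    rowScale (fun _ => ((R : ℝ) + 1)⁻¹) x ∈ posPmf R S := by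
  refine ⟨fun i j => ?_, ?_⟩
  · exact div_pos (mul_pos (by positivity) (hx.1 i j)) (rowSum_pos hx.1 i)
  · simp only [sum_rowScale _ hx.1]
    have : (R : ℝ) + 1 ≠ 0 := by positivity
    simp [this]

theorem sumLog_rowScale {R S : ℕ} {x : Table R S} (hx : x ∈ posPmf R S) :
    sumLog (rowScale (fun _ => ((R : ℝ) + 1)⁻¹) x)
      = sumLog x - ((S : ℝ) + 1) * ∑ i, Real.log (((R : ℝ) + 1) * ∑ j, x i j) := by
  have hR : (0 : ℝ) < (R : ℝ) + 1 := by positivity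
  simp only [sumLog, log_rowScale (fun _ => inv_pos.2 hR) hx.1, Finset.sum_add_distrib]
  rw [Finset.mul_sum, sub_eq_add_neg, ← Finset.sum_neg_distrib]
  congr 1
  refine Finset.sum_congr rfl fun i _ => ?_
  rw [Real.log_mul hR.ne' (rowSum_pos hx.1 i).ne', Real.log_inv]
  simp
  ring

theorem log_rowSum_le {R S : ℕ} {x : Table R S} (hx : x ∈ posPmf R S) (i : Fin (R + 1)) :
    0 ≤ ((R : ℝ) + 1) * ∑ j, x i j - 1 - Real.log (((R : ℝ) + 1) * ∑ j, x i j) :=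
  sub_nonneg.2 (Real.log_le_sub_one_of_pos (mul_pos (by positivity) (rowSum_pos hx.1 i)))

/-- The normalized row sums `t_i` have mean one, so the terms `t_i - 1` cancel and only the deficits
in `log t ≤ t - 1` remain. -/
theorem sum_log_rowSum {R S : ℕ} {x : Table R S} (hx : x ∈ posPmf R S) :
    ∑ i, Real.log (((R : ℝ) + 1) * ∑ j, x i j)
      = -∑ i, (((R : ℝ) + 1) * ∑ j, x i j - 1 - Real.log (((R : ℝ) + 1) * ∑ j, x i j)) := by
  simp only [Finset.sum_sub_distrib, ← Finset.mul_sum, hx.2]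
  simp

theorem sumLog_le_rowScale {R S : ℕ} {x : Table R S} (hx : x ∈ posPmf R S) :
    sumLog x ≤ sumLog (rowScale (fun _ => ((R : ℝ) + 1)⁻¹) x) := by
  rw [sumLog_rowScale hx, sum_log_rowSum hx]
  have := Finset.sum_nonneg fun i (_ : i ∈ Finset.univ) => log_rowSum_le hx i
  have : 0 ≤ ((S : ℝ) + 1) * _ := mul_nonneg (by positivity) this
  linarith

/-- The gain in the sum of logarithms is a positive multiple of the total deficit in `log t ≤ t -
1`, where equality holds only at `t = 1`. -/
theorem rowSum_eq_of_sumLog_eq {R S : ℕ} {x : Table R S} (hx : x ∈ posPmf R S)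
    (h : sumLog (rowScale (fun _ => ((R : ℝ) + 1)⁻¹) x) = sumLog x) (i : Fin (R + 1)) :
    ∑ j, x i j = ((R : ℝ) + 1)⁻¹ := by
  have hR : (0 : ℝ) < (R : ℝ) + 1 := by positivity
  have hS : (0 : ℝ) < (S : ℝ) + 1 := by positivity
  rw [sumLog_rowScale hx, sub_eq_self, mul_eq_zero_iff_left hS.ne', sum_log_rowSum hx,
    neg_eq_zero, Finset.sum_eq_zero_iff_of_nonneg fun i _ => log_rowSum_le hx i] at h
  have hi := h i (Finset.mem_univ i)
  by_contra hne
  have := Real.log_lt_sub_one_of_pos (mul_pos hR (rowSum_pos hx.1 i)) (fun h1 =>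
    hne (eq_inv_of_mul_eq_one_right h1))
  linarith

theorem rowScale_of_rowSum_eq {R S : ℕ} {a : Fin (R + 1) → ℝ} (ha : ∀ i, 0 < a i) {x : Table R S}
    (h : ∀ i, ∑ j, x i j = a i) : rowScale a x = x := by
  ext i j
  simp [rowScale, h, mul_div_cancel_left₀ _ (ha i).ne']

/-- Transposition transfers every result on rows to columns. -/
theorem colScale_eq_transpose {R S : ℕ} (b : Fin (S + 1) → ℝ) (x : Table R S) :
    colScale b x = (rowScale b x.transpose).transpose := by
  ext i j
  simp [colScale, rowScale]

theorem transpose_mem_posPmf {R S : ℕ} {x : Table R S} (hx : x ∈ posPmf R S) :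
    x.transpose ∈ posPmf S R :=
  ⟨fun i j => hx.1 j i, Finset.sum_comm.trans hx.2⟩

theorem sumLog_transpose {R S : ℕ} (x : Table R S) : sumLog x.transpose = sumLog x :=
  Finset.sum_comm

theorem colScale_mem_posPmf {R S : ℕ} {x : Table R S} (hx : x ∈ posPmf R S) :
    colScale (fun _ => ((S : ℝ) + 1)⁻¹) x ∈ posPmf R S := by
  rw [colScale_eq_transpose]
  exact transpose_mem_posPmf (rowScale_mem_posPmf (transpose_mem_posPmf hx))

theorem sumLog_le_colScale {R S : ℕ} {x : Table R S} (hx : x ∈ posPmf R S) :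
    sumLog x ≤ sumLog (colScale (fun _ => ((S : ℝ) + 1)⁻¹) x) := by
  rw [colScale_eq_transpose, sumLog_transpose, ← sumLog_transpose x]
  exact sumLog_le_rowScale (transpose_mem_posPmf hx)

theorem colSum_eq_of_sumLog_eq {R S : ℕ} {x : Table R S} (hx : x ∈ posPmf R S)
    (h : sumLog (colScale (fun _ => ((S : ℝ) + 1)⁻¹) x) = sumLog x) (j : Fin (S + 1)) :
    ∑ i, x i j = ((S : ℝ) + 1)⁻¹ := by
  rw [colScale_eq_transpose, sumLog_transpose, ← sumLog_transpose x] at h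
  exact rowSum_eq_of_sumLog_eq (transpose_mem_posPmf hx) h j

theorem logOdds_rowScale {R S : ℕ} {x : Table R S} (hx : x ∈ posPmf R S) :
    logOdds (rowScale (fun _ => ((R : ℝ) + 1)⁻¹) x) = logOdds x :=
  logOdds_congr_of_add (a := fun i => Real.log ((R : ℝ) + 1)⁻¹ - Real.log (∑ j, x i j)) (b := 0)
    fun i j => by
      rw [log_rowScale (fun _ => by positivity) hx.1]
      simp only [Pi.zero_apply, add_zero]

theorem logOdds_colScale {R S : ℕ} {x : Table R S} (hx : x ∈ posPmf R S) :
    logOdds (colScale (fun _ => ((S : ℝ) + 1)⁻¹) x) = logOdds x :=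
  logOdds_congr_of_add (a := 0)
    (b := fun j => Real.log ((S : ℝ) + 1)⁻¹ - Real.log (∑ i, x i j)) fun i j => by
      rw [colScale_eq_transpose, Matrix.transpose_apply,
        log_rowScale (fun _ => by positivity) (transpose_mem_posPmf hx).1]
      simp only [Pi.zero_apply, add_zero, Matrix.transpose_apply]

/-- One cycle of the procedure with uniform target margins. -/
noncomputable def ipfpCycle {R S : ℕ} (x : Table R S) : Table R S :=
  colScale (fun _ => ((S : ℝ) + 1)⁻¹) (rowScale (fun _ => ((R : ℝ) + 1)⁻¹) x)

theorem continuousAt_rowScale {R S : ℕ} (a : Fin (R + 1) → ℝ) {x : Table R S}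
    (hx : ∀ i j, 0 < x i j) : ContinuousAt (rowScale a) x := by
  refine continuousAt_pi.2 fun i => continuousAt_pi.2 fun j => ?_
  have hc : ∀ i j, ContinuousAt (fun y : Table R S => y i j) x := fun i j =>
    (continuous_id.matrix_elem i j).continuousAt
  exact (continuousAt_const.mul (hc i j)).div (tendsto_finsetSum _ fun j _ => hc i j)
    (rowSum_pos hx i).ne'

theorem continuousAt_colScale {R S : ℕ} (b : Fin (S + 1) → ℝ) {x : Table R S}
    (hx : ∀ i j, 0 < x i j) : ContinuousAt (colScale b) x := by
  have : colScale b = fun x : Table R S => (rowScale b x.transpose).transpose :=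
    funext fun x => colScale_eq_transpose b x
  rw [this]
  have h1 : Continuous (Matrix.transpose : Table R S → Table S R) := continuous_id.matrix_transpose
  have h2 : Continuous (Matrix.transpose : Table S R → Table R S) := continuous_id.matrix_transpose
  refine h2.continuousAt.comp ?_
  exact ContinuousAt.comp (g := rowScale b) (continuousAt_rowScale b fun i j => hx j i)
    h1.continuousAt

theorem continuousAt_sumLog {R S : ℕ} {x : Table R S} (hx : ∀ i j, 0 < x i j) :
    ContinuousAt sumLog x := by
  have hc : ∀ i j, ContinuousAt (fun y : Table R S => y i j) x := fun i j =>
    (continuous_id.matrix_elem i j).continuousAt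
  exact tendsto_finsetSum _ fun i _ => tendsto_finsetSum _ fun j _ =>
    (hc i j).log (hx i j).ne'

theorem continuousAt_logOdds {R S : ℕ} {x : Table R S} (hx : ∀ i j, 0 < x i j) :
    ContinuousAt logOdds x := by
  refine continuousAt_pi.2 fun d => ?_
  have hc : ∀ i j, ContinuousAt (fun y : Table R S => Real.log (y i j)) x := fun i j =>
    ContinuousAt.log (continuous_id.matrix_elem i j).continuousAt (hx i j).ne'
  simp only [logOdds, matK_transpose_mulVec]
  exact (((hc _ _).sub (hc _ _)).sub (hc _ _)).add (hc _ _)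

theorem ipfpCycle_mem_posPmf {R S : ℕ} {x : Table R S} (hx : x ∈ posPmf R S) :
    ipfpCycle x ∈ posPmf R S := colScale_mem_posPmf (rowScale_mem_posPmf hx)

theorem iterate_ipfpCycle_mem_posPmf {R S : ℕ} {x : Table R S} (hx : x ∈ posPmf R S) (n : ℕ) :
    ipfpCycle^[n] x ∈ posPmf R S := by
  induction n with
  | zero => exact hx
  | succ n ih => rw [Function.iterate_succ_apply']; exact ipfpCycle_mem_posPmf ih

theorem le_one_of_mem_posPmf {R S : ℕ} {x : Table R S} (hx : x ∈ posPmf R S) (i : Fin (R + 1))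
    (j : Fin (S + 1)) : x i j ≤ 1 := by
  rw [← hx.2]
  exact (Finset.single_le_sum (fun j _ => (hx.1 i j).le) (Finset.mem_univ j)).trans
    (Finset.single_le_sum (f := fun i => ∑ j, x i j) (fun i _ => (rowSum_pos hx.1 i).le)
      (Finset.mem_univ i))

/-- All logarithms are nonpositive, so their sum is below each of them. A lower bound on the sum
thus keeps every entry away from zero. -/
theorem sumLog_le_log {R S : ℕ} {x : Table R S} (hx : x ∈ posPmf R S) (i : Fin (R + 1))
    (j : Fin (S + 1)) : sumLog x ≤ Real.log (x i j) := by
  have h : ∀ i j, Real.log (x i j) ≤ 0 := fun i j =>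
    Real.log_nonpos (hx.1 i j).le (le_one_of_mem_posPmf hx i j)
  have h1 := Finset.single_le_sum (f := fun j => -Real.log (x i j))
    (fun j _ => neg_nonneg.2 (h i j)) (Finset.mem_univ j)
  have h2 := Finset.single_le_sum (f := fun i => ∑ j, -Real.log (x i j))
    (fun i _ => Finset.sum_nonneg fun j _ => neg_nonneg.2 (h i j)) (Finset.mem_univ i)
  simp only [Finset.sum_neg_distrib] at h1 h2
  rw [sumLog]
  linarith

theorem sumLog_iterate_mono {R S : ℕ} {x : Table R S} (hx : x ∈ posPmf R S) :
    Monotone fun n => sumLog (ipfpCycle^[n] x) := by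
  refine monotone_nat_of_le_succ fun n => ?_
  rw [Function.iterate_succ_apply']
  have h := iterate_ipfpCycle_mem_posPmf hx n
  exact (sumLog_le_rowScale h).trans (sumLog_le_colScale (rowScale_mem_posPmf h))

theorem logOdds_iterate {R S : ℕ} {x : Table R S} (hx : x ∈ posPmf R S) (n : ℕ) :
    logOdds (ipfpCycle^[n] x) = logOdds x := by
  induction n with
  | zero => rfl
  | succ n ih =>
    have h := iterate_ipfpCycle_mem_posPmf hx n
    rw [Function.iterate_succ_apply', ipfpCycle, logOdds_colScale (rowScale_mem_posPmf h),
      logOdds_rowScale h, ih]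

/-- Ultrafilters replace subsequences: compactness gives a limit, and the sum of logarithms serves
as a strict Lyapunov function that identifies it as a fixed point. -/
theorem exists_tendsto_ultrafilter {R S : ℕ} {x : Table R S} (hx : x ∈ posPmf R S)
    (g : Ultrafilter ℕ) (hg : (g : Filter ℕ) ≤ atTop) :
    ∃ v ∈ posCopulaPmf R S, logOdds v = logOdds x ∧
      Tendsto (fun n => ipfpCycle^[n] x) g (𝓝 v) := by
  have hmem := iterate_ipfpCycle_mem_posPmf hx
  set y : ℕ → Table R S := fun n => ipfpCycle^[n] x with hy
  have hylow : ∀ n i j, Real.exp (sumLog x) ≤ y n i j := fun n i j => by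
    rw [← Real.le_log_iff_exp_le ((hmem n).1 i j)]
    exact (sumLog_iterate_mono hx (Nat.zero_le n)).trans (sumLog_le_log (hmem n) i j)
  have hK : IsCompact (Set.univ.pi fun _ => Set.univ.pi fun _ =>
      Set.Icc (Real.exp (sumLog x)) 1 : Set (Fin (R + 1) → Fin (S + 1) → ℝ)) :=
    isCompact_univ_pi fun _ => isCompact_univ_pi fun _ => isCompact_Icc
  obtain ⟨v, hvK, hv⟩ := hK.ultrafilter_le_nhds (g.map y) (by
    rw [le_principal_iff]
    refine Ultrafilter.mem_coe.1 (Ultrafilter.mem_map.2 (Filter.mem_of_superset Filter.univ_mem ?_))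
    intro n _ i _ j _
    exact ⟨hylow n i j, le_one_of_mem_posPmf (hmem n) i j⟩)
  have hyv : Tendsto y g (𝓝 (v : Table R S)) := hv
  have hv0 : ∀ i j, 0 < v i j := fun i j =>
    (Real.exp_pos _).trans_le (hvK i trivial j trivial).1
  have hev : ∀ i j, Tendsto (fun n => y n i j) g (𝓝 (v i j)) := fun i j =>
    tendsto_pi_nhds.1 (tendsto_pi_nhds.1 hyv i) j
  have hvp : (v : Table R S) ∈ posPmf R S := by
    refine ⟨hv0, tendsto_nhds_unique (tendsto_finsetSum _ fun i _ => tendsto_finsetSum _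
      fun j _ => hev i j) ?_⟩
    simp only [(hmem _).2, hy]
    exact tendsto_const_nhds
  obtain ⟨ℓ, hℓ⟩ : ∃ ℓ, Tendsto (fun n => sumLog (y n)) atTop (𝓝 ℓ) :=
    ⟨_, tendsto_atTop_ciSup (sumLog_iterate_mono hx) ⟨0, by
      rintro _ ⟨n, rfl⟩
      exact (sumLog_le_log (hmem n) 0 0).trans
        (Real.log_nonpos ((hmem n).1 _ _).le (le_one_of_mem_posPmf (hmem n) _ _))⟩⟩
  have h1 : sumLog (v : Table R S) = ℓ := tendsto_nhds_unique
    ((continuousAt_sumLog (x := (v : Table R S)) hv0).tendsto.comp hyv) (hℓ.mono_left hg)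
  have hrow := rowScale_mem_posPmf hvp
  -- One more cycle shifts the sequence, whose sums of logarithms have the same limit. Both
  -- half-steps from `v` therefore gain nothing, which forces uniform row and then column sums.
  have h2 : sumLog (ipfpCycle (v : Table R S)) = ℓ := by
    have hc : ContinuousAt ipfpCycle (v : Table R S) :=
      ContinuousAt.comp (g := colScale fun _ => ((S : ℝ) + 1)⁻¹)
        (continuousAt_colScale _ hrow.1) (continuousAt_rowScale _ hv0)
    refine tendsto_nhds_unique ((continuousAt_sumLog (ipfpCycle_mem_posPmf hvp).1).tendsto.comp
      (hc.tendsto.comp hyv)) (((hℓ.comp (tendsto_add_atTop_nat 1)).mono_left hg).congr fun n => ?_)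
    simp only [Function.comp_apply, hy, Function.iterate_succ_apply']
  have h3 := sumLog_le_rowScale hvp
  have h4 := sumLog_le_colScale hrow
  unfold ipfpCycle at h2
  have hr := rowSum_eq_of_sumLog_eq hvp (by linarith)
  have heq : rowScale (fun _ => ((R : ℝ) + 1)⁻¹) (v : Table R S) = v :=
    rowScale_of_rowSum_eq (fun _ => by positivity) hr
  rw [heq] at h2
  refine ⟨v, ⟨hvp, hr, colSum_eq_of_sumLog_eq hvp (by linarith)⟩, ?_, hyv⟩
  refine tendsto_nhds_unique ((continuousAt_logOdds (x := (v : Table R S)) hv0).tendsto.comp hyv) ?_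
  refine tendsto_const_nhds.congr fun n => ?_
  exact (logOdds_iterate hx n).symm

/-- The procedure started at a p.m.f. with full support converges, and its limit is the copula
p.m.f. with the same odds ratios. -/
theorem exists_tendsto_ipfpStep {R S : ℕ} {x : Table R S} (hx : x ∈ posPmf R S) :
    ∃ v ∈ posCopulaPmf R S, logOdds v = logOdds x ∧
      Tendsto (fun N => ipfpStep (fun _ => ((R : ℝ) + 1)⁻¹) (fun _ => ((S : ℝ) + 1)⁻¹) N x)
        atTop (𝓝 v) := by
  obtain ⟨v, hv, hvx, -⟩ := exists_tendsto_ultrafilter hx (hyperfilter ℕ)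
    (by rw [← Nat.cofinite_eq_atTop]; exact hyperfilter_le_cofinite)
  refine ⟨v, hv, hvx, ?_⟩
  -- All ultrafilter limits share the odds ratios of `x`, so they coincide and the whole sequence
  -- converges.
  have hT : Tendsto (fun n => ipfpCycle^[n] x) atTop (𝓝 v) := by
    refine (tendsto_iff_ultrafilter _ _ _).2 fun g hg => ?_
    obtain ⟨w, hw, hwx, hwt⟩ := exists_tendsto_ultrafilter hx g hg
    rwa [eq_of_logOdds_eq hv hw (hvx.trans hwx.symm)]
  -- The odd steps have the same limit because `v` already has uniform row sums and is fixed by row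
  -- scaling.
  have hR : Tendsto (fun n => rowScale (fun _ => ((R : ℝ) + 1)⁻¹) (ipfpCycle^[n] x)) atTop
      (𝓝 v) := by
    have := (continuousAt_rowScale (fun _ => ((R : ℝ) + 1)⁻¹) hv.1.1).tendsto.comp hT
    rwa [rowScale_of_rowSum_eq (fun _ => by positivity) hv.2.1] at this
  have hdiv : Tendsto (fun N : ℕ => N / 2) atTop atTop := Nat.tendsto_div_const_atTop two_ne_zero
  exact Tendsto.if' (hT.comp hdiv) (hR.comp hdiv)

theorem ipfpUnif_spec {R S : ℕ} {x : Table R S} (hx : x ∈ posPmf R S) :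
    ipfpUnif x ∈ posCopulaPmf R S ∧ logOdds (ipfpUnif x) = logOdds x := by
  obtain ⟨v, hv, hvx, ht⟩ := exists_tendsto_ipfpStep hx
  have : ipfpUnif x = v := ht.limUnder_eq
  exact this ▸ ⟨hv, hvx⟩

theorem ipfpUnif_eq {R S : ℕ} {x v : Table R S} (hx : x ∈ posPmf R S) (hv : v ∈ posCopulaPmf R S)
    (h : logOdds v = logOdds x) : ipfpUnif x = v :=
  eq_of_logOdds_eq (ipfpUnif_spec hx).1 hv ((ipfpUnif_spec hx).2.trans h.symm)

/-! ### Differentiability of the map `𝒰` -/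

/-- The table with a given vectorization. -/
def unvec {R S : ℕ} (x : Cell R S → ℝ) : Table R S := Matrix.of fun i j => x (i, j)

/-- Multiplication by a matrix as a continuous linear map. -/
noncomputable def mulVecCLM {ι κ : Type*} [Fintype ι] [Fintype κ] (A : Matrix ι κ ℝ) :
    (κ → ℝ) →L[ℝ] (ι → ℝ) := LinearMap.toContinuousLinearMap A.mulVecLin

@[simp] theorem mulVecCLM_apply {ι κ : Type*} [Fintype ι] [Fintype κ] (A : Matrix ι κ ℝ)
    (x : κ → ℝ) : mulVecCLM A x = A.mulVec x := rfl

theorem hasStrictFDerivAt_log_comp {ι : Type*} [Fintype ι] [DecidableEq ι] {x : ι → ℝ}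
    (hx : ∀ i, x i ≠ 0) :
    HasStrictFDerivAt (fun (y : ι → ℝ) i => Real.log (y i))
      (mulVecCLM (Matrix.diagonal fun i => (x i)⁻¹)) x := by
  refine hasStrictFDerivAt_pi'.2 fun i => ?_
  have h := HasStrictFDerivAt.log (hasStrictFDerivAt_apply (𝕜 := ℝ) i x) (hx i)
  refine h.congr_fderiv ?_
  ext y
  simp [Matrix.mulVec_diagonal]

theorem add_matK_mulVec_mem_posCopulaPmf {R S : ℕ} {v : Table R S} (hv : v ∈ posCopulaPmf R S)
    (d : InnerCell R S → ℝ) (hpos : ∀ c, 0 < (vec v + (matK R S).mulVec d) c) :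
    unvec (vec v + (matK R S).mulVec d) ∈ posCopulaPmf R S := by
  obtain ⟨⟨-, hv1⟩, hvr, hvc⟩ := hv
  refine ⟨⟨fun i j => hpos (i, j), ?_⟩, fun i => ?_, fun j => ?_⟩
  · simp only [unvec, Matrix.of_apply, Pi.add_apply, Finset.sum_add_distrib, vec, hv1,
      sum_snd_matK_mulVec]
    simp
  · simp only [unvec, Matrix.of_apply, Pi.add_apply, Finset.sum_add_distrib, vec, hvr,
      sum_snd_matK_mulVec, add_zero]
  · simp only [unvec, Matrix.of_apply, Pi.add_apply, Finset.sum_add_distrib, vec, hvc,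
      sum_fst_matK_mulVec, add_zero]

/-- The map `𝒰` is differentiable, with derivative `J_{u,p}` in the directions that preserve the
total mass. -/
theorem exists_hasFDerivWithinAt_ipfpUnif {R S : ℕ} {p : Table R S} (hp : p ∈ posPmf R S) :
    ∃ D : (Cell R S → ℝ) →L[ℝ] (Cell R S → ℝ),
      HasFDerivWithinAt (fun x => vec (ipfpUnif (unvec x))) D {x | unvec x ∈ posPmf R S} (vec p) ∧
      ∀ h, ∑ c, h c = 0 → D h = (matJ (ipfpUnif p) p).mulVec h := by
  obtain ⟨hu, hup⟩ := ipfpUnif_spec hp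
  set u := ipfpUnif p with hu_def
  set K := matK R S with hK
  set Lg : (Cell R S → ℝ) → (Cell R S → ℝ) := fun y c => Real.log (y c) with hLg
  have hLunit := isUnit_matL hu
  have hLdet : IsUnit (matL u).det := (Matrix.isUnit_iff_isUnit_det _).1 hLunit
  let E : (InnerCell R S → ℝ) ≃L[ℝ] (InnerCell R S → ℝ) :=
    ContinuousLinearEquiv.equivOfInverse (mulVecCLM (matL u)) (mulVecCLM (matL u)⁻¹)
      (fun x => by simp [Matrix.nonsing_inv_mul _ hLdet])
      (fun x => by simp [Matrix.mul_nonsing_inv _ hLdet])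
  -- log odds ratios in the coordinates given by the inner cells
  let g : (InnerCell R S → ℝ) → (InnerCell R S → ℝ) := fun d =>
    mulVecCLM K.transpose (Lg (vec u + mulVecCLM K d))
  have hg : HasStrictFDerivAt g (E : (InnerCell R S → ℝ) →L[ℝ] (InnerCell R S → ℝ)) 0 := by
    have h1 : HasStrictFDerivAt (fun d => vec u + mulVecCLM K d) (mulVecCLM K) 0 :=
      (mulVecCLM K).hasStrictFDerivAt.const_add _
    have h2 : HasStrictFDerivAt Lg (mulVecCLM (Matrix.diagonal fun c => (vec u c)⁻¹))
        (vec u + mulVecCLM K 0) := by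
      rw [map_zero, add_zero]
      exact hasStrictFDerivAt_log_comp fun c => (hu.1.1 _ _).ne'
    refine ((mulVecCLM K.transpose).hasStrictFDerivAt.comp 0 (h2.comp 0 h1)).congr_fderiv ?_
    refine ContinuousLinearMap.ext fun x => ?_
    change K.transpose.mulVec ((Matrix.diagonal fun c => (vec u c)⁻¹).mulVec (K.mulVec x))
      = (matL u).mulVec x
    rw [matL_eq hu, Matrix.mulVec_mulVec, Matrix.mulVec_mulVec]
  have hg0 : g 0 = mulVecCLM K.transpose (Lg (vec p)) := by
    simp only [g, map_zero, add_zero]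
    exact hup
  have hinv := hg.to_localInverse.hasFDerivAt
  have hlog : HasFDerivAt (fun x => mulVecCLM K.transpose (Lg x))
      ((mulVecCLM K.transpose).comp (mulVecCLM (Matrix.diagonal fun c => (vec p c)⁻¹))) (vec p) :=
    ((mulVecCLM K.transpose).hasStrictFDerivAt.comp _
      (hasStrictFDerivAt_log_comp fun c => (hp.1 _ _).ne')).hasFDerivAt
  rw [hg0] at hinv
  have hd := HasFDerivAt.comp (vec p) hinv hlog
  have hF := ((mulVecCLM K).hasFDerivAt.comp (vec p) hd).const_add (vec u)
  have hp' : unvec (vec p) = p := rfl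
  -- For `x` near `p`, the candidate built from the local inverse has exactly the odds ratios of
  -- `x`.
  have hright := hlog.continuousAt.eventually (hg0 ▸ hg.eventually_right_inverse)
  have hd0 : hg.localInverse g E 0 (mulVecCLM K.transpose (Lg (vec p))) = 0 := by
    rw [← hg0]
    exact hg.localInverse_apply_image
  have hF0 : vec u + mulVecCLM K (hg.localInverse g E 0 (mulVecCLM K.transpose (Lg (vec p))))
      = vec u := by rw [hd0]; simp
  -- Adding an element of the range of `K` preserves the margins, so positivity is all that the
  -- candidate needs in order to be a copula p.m.f.; it holds near `p` by continuity.
  have hpos : ∀ᶠ x in 𝓝 (vec p), ∀ c, 0 < (vec u + mulVecCLM K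
      (hg.localInverse g E 0 (mulVecCLM K.transpose (Lg x)))) c := by
    refine eventually_all.2 fun c => ?_
    have hc := (continuous_apply c).continuousAt.tendsto.comp hF.continuousAt.tendsto
    refine hc.eventually (lt_mem_nhds ?_)
    change 0 < (vec u + mulVecCLM K
      (hg.localInverse g E 0 (mulVecCLM K.transpose (Lg (vec p))))) c
    rw [hF0]
    exact hu.1.1 _ _
  refine ⟨_, hF.hasFDerivWithinAt.congr_of_eventuallyEq ?_ ?_, fun h hh => ?_⟩
  · filter_upwards [self_mem_nhdsWithin, mem_nhdsWithin_of_mem_nhds hright,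
      mem_nhdsWithin_of_mem_nhds hpos] with x hx hxr hxpos
    have := ipfpUnif_eq hx (add_matK_mulVec_mem_posCopulaPmf hu _ hxpos) hxr
    rw [this]
    rfl
  · rw [hp']
    exact hF0.symm
  · have h3 := matM_mul_matN_mulVec hp h hh
    change K.mulVec ((matL u)⁻¹.mulVec (K.transpose.mulVec
      ((Matrix.diagonal fun c => (vec p c)⁻¹).mulVec h))) = _
    rw [matJ, Matrix.mul_assoc, Matrix.neg_mulVec, ← Matrix.mulVec_mulVec,
      ← Matrix.mulVec_mulVec, h3, Matrix.mulVec_neg, Matrix.mulVec_neg, neg_neg]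
    congr 3
    ext c
    simp [Matrix.mulVec_diagonal]

/-! ### Convergence and boundedness in probability -/

section Prob

variable {Ω : Type*} [MeasurableSpace Ω]

/-- The filter on `ℕ × Ω` along which convergence is convergence in probability as `n → ∞`. -/
def probFilter (P : Measure Ω) : Filter (ℕ × Ω) where
  sets := {s | Tendsto (fun n => P {ω | (n, ω) ∉ s}) atTop (𝓝 0)}
  univ_sets := by simp
  sets_of_superset {s t} hs hst := tendsto_of_tendsto_of_tendsto_of_le_of_le tendsto_const_nhds hs
    (fun _ => zero_le) fun n => measure_mono fun ω hω h => hω (hst h)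
  inter_sets {s t} hs ht := by
    have h := Tendsto.add hs ht
    rw [add_zero] at h
    refine tendsto_of_tendsto_of_tendsto_of_le_of_le tendsto_const_nhds h (fun _ => zero_le)
      fun n => (measure_mono fun ω hω => ?_).trans (measure_union_le _ _)
    simp only [Set.mem_inter_iff, Set.mem_ofPred_eq, not_and_or] at hω
    exact hω

theorem mem_probFilter {P : Measure Ω} {s : Set (ℕ × Ω)} :
    s ∈ probFilter P ↔ Tendsto (fun n => P {ω | (n, ω) ∉ s}) atTop (𝓝 0) := Iff.rfl

theorem tendsto_fst_probFilter (P : Measure Ω) : Tendsto Prod.fst (probFilter P) atTop := by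
  refine tendsto_atTop.2 fun N => ?_
  refine mem_probFilter.2 (tendsto_const_nhds.congr' ?_)
  filter_upwards [eventually_ge_atTop N] with n hn
  simp [hn]

theorem tendstoInMeasure_iff_tendsto_probFilter {E : Type*} [PseudoMetricSpace E] {P : Measure Ω}
    {X : ℕ → Ω → E} {c : E} :
    TendstoInMeasure P X atTop (fun _ => c)
      ↔ Tendsto (fun z : ℕ × Ω => X z.1 z.2) (probFilter P) (𝓝 c) := by
  rw [tendstoInMeasure_iff_dist, Metric.nhds_basis_ball.tendsto_right_iff]
  refine forall₂_congr fun ε _ => ?_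
  simp [Filter.Eventually, mem_probFilter]

/-- Boundedness in probability of a sequence of random elements. -/
def BddInProb {E : Type*} [Norm E] (P : Measure Ω) (X : ℕ → Ω → E) : Prop :=
  ∀ ε : ENNReal, 0 < ε → ∃ M : ℝ, ∀ᶠ n in atTop, P {ω | M < ‖X n ω‖} ≤ ε

theorem BddInProb.of_norm_le {E F : Type*} [Norm E] [Norm F] {P : Measure Ω} {X : ℕ → Ω → E}
    {Y : ℕ → Ω → F} (hX : BddInProb P X) {C : ℝ} (hC : 0 ≤ C)
    (h : ∀ n ω, ‖Y n ω‖ ≤ C * ‖X n ω‖) : BddInProb P Y := by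
  intro ε hε
  obtain ⟨M, hM⟩ := hX ε hε
  refine ⟨C * M, hM.mono fun n hn => (measure_mono fun ω hω => ?_).trans hn⟩
  simp only [Set.mem_ofPred_eq] at hω ⊢
  by_contra hle
  exact absurd (hω.trans_le (h n ω)) (not_lt.2 (mul_le_mul_of_nonneg_left (not_lt.1 hle) hC))

theorem BddInProb.map {E F : Type*} [NormedAddCommGroup E] [NormedSpace ℝ E]
    [NormedAddCommGroup F] [NormedSpace ℝ F] {P : Measure Ω} {X : ℕ → Ω → E}
    (hX : BddInProb P X) (D : E →L[ℝ] F) : BddInProb P fun n ω => D (X n ω) :=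
  hX.of_norm_le (norm_nonneg D) fun _ _ => D.le_opNorm _

theorem BddInProb.add {E : Type*} [SeminormedAddCommGroup E] {P : Measure Ω} {X Y : ℕ → Ω → E}
    (hX : BddInProb P X) (hY : BddInProb P Y) : BddInProb P fun n ω => X n ω + Y n ω := by
  intro ε hε
  obtain ⟨M, hM⟩ := hX (ε / 2) (ENNReal.half_pos hε.ne')
  obtain ⟨N, hN⟩ := hY (ε / 2) (ENNReal.half_pos hε.ne')
  refine ⟨M + N, ?_⟩
  filter_upwards [hM, hN] with n h1 h2
  calc P {ω | M + N < ‖X n ω + Y n ω‖}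
      ≤ P ({ω | M < ‖X n ω‖} ∪ {ω | N < ‖Y n ω‖}) := measure_mono fun ω hω => by
        simp only [Set.mem_ofPred_eq, Set.mem_union] at hω ⊢
        by_contra! hle
        exact absurd hω (not_lt.2 ((norm_add_le _ _).trans (add_le_add hle.1 hle.2)))
    _ ≤ ε / 2 + ε / 2 := (measure_union_le _ _).trans (add_le_add h1 h2)
    _ = ε := ENNReal.add_halves ε

theorem bddInProb_of_tendsto {E : Type*} [SeminormedAddCommGroup E] {P : Measure Ω}
    {X : ℕ → Ω → E} {c : E}
    (h : Tendsto (fun z : ℕ × Ω => X z.1 z.2) (probFilter P) (𝓝 c)) : BddInProb P X := by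
  intro ε hε
  refine ⟨‖c‖ + 1, ?_⟩
  have h1 := h.norm.eventually (gt_mem_nhds (lt_add_one ‖c‖))
  filter_upwards [(mem_probFilter.1 h1).eventually (gt_mem_nhds hε)] with n hn
  refine (measure_mono fun ω hω => ?_).trans hn.le
  simp only [Set.mem_ofPred_eq] at hω ⊢
  exact not_lt.2 hω.le

theorem bddInProb_pi {ι : Type*} [Fintype ι] {P : Measure Ω} {X : ℕ → Ω → ι → ℝ}
    (h : ∀ i, BddInProb P fun n ω => X n ω i) : BddInProb P X := by
  classical
  have hsum : ∀ s : Finset ι, BddInProb P fun n ω => ∑ i ∈ s, ‖X n ω i‖ := by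
    intro s
    induction s using Finset.induction_on with
    | empty =>
      simp only [Finset.sum_empty]
      exact bddInProb_of_tendsto tendsto_const_nhds
    | insert a s ha ih =>
      simp only [Finset.sum_insert ha]
      exact ((h a).of_norm_le zero_le_one fun n ω => by simp).add ih
  refine (hsum Finset.univ).of_norm_le zero_le_one fun n ω => ?_
  rw [one_mul, Real.norm_of_nonneg (Finset.sum_nonneg fun _ _ => norm_nonneg _)]
  exact (pi_norm_le_iff_of_nonneg (Finset.sum_nonneg fun _ _ => norm_nonneg _)).2 fun i =>
    Finset.single_le_sum (f := fun i => ‖X n ω i‖) (fun _ _ => norm_nonneg _) (Finset.mem_univ i)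

/-- This is `o_P(1) · O_P(1) = o_P(1)`: outside two events of small probability, one factor is
bounded and the other is tiny. -/
theorem BddInProb.smul_tendsto_zero {E : Type*} [NormedAddCommGroup E] [NormedSpace ℝ E]
    {P : Measure Ω} {X : ℕ → Ω → E} {ρ : ℕ × Ω → ℝ} (hX : BddInProb P X)
    (hρ : Tendsto ρ (probFilter P) (𝓝 0)) :
    Tendsto (fun z : ℕ × Ω => ρ z • X z.1 z.2) (probFilter P) (𝓝 0) := by
  rw [Metric.nhds_basis_ball.tendsto_right_iff]
  intro ε hε
  rw [Filter.Eventually, mem_probFilter, ENNReal.tendsto_nhds_zero]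
  intro δ hδ
  obtain ⟨M, hM⟩ := hX (δ / 2) (ENNReal.half_pos hδ.ne')
  have hM0 : 0 < |M| + 1 := by positivity
  have h1 : ∀ᶠ z in probFilter P, |ρ z| < ε / (|M| + 1) := by
    have := hρ.abs
    rw [abs_zero] at this
    exact this.eventually (gt_mem_nhds (div_pos hε hM0))
  filter_upwards [hM, (mem_probFilter.1 h1).eventually (gt_mem_nhds (ENNReal.half_pos hδ.ne'))]
    with n h2 h3
  refine le_trans (measure_mono (fun ω hω => ?_)) ((measure_union_le
    {ω | M < ‖X n ω‖} _).trans ((add_le_add h2 h3.le).trans_eq (ENNReal.add_halves δ)))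
  simp only [Set.mem_ofPred_eq, Set.mem_union, mem_ball_zero_iff, norm_smul, Real.norm_eq_abs,
    not_lt] at hω ⊢
  by_contra! hle
  refine absurd hω (not_le.2 ?_)
  calc |ρ (n, ω)| * ‖X n ω‖ ≤ |ρ (n, ω)| * (|M| + 1) := by
        refine mul_le_mul_of_nonneg_left ?_ (abs_nonneg _)
        linarith [hle.1, le_abs_self M]
    _ < ε / (|M| + 1) * (|M| + 1) := mul_lt_mul_of_pos_right hle.2 hM0
    _ = ε := div_mul_cancel₀ _ hM0.ne'

theorem tendsto_of_bddInProb_sqrt {E : Type*} [NormedAddCommGroup E] [NormedSpace ℝ E]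
    {P : Measure Ω} {Y : ℕ → Ω → E} {a : E}
    (h : BddInProb P fun n ω => √(n : ℝ) • (Y n ω - a)) :
    Tendsto (fun z : ℕ × Ω => Y z.1 z.2) (probFilter P) (𝓝 a) := by
  have hρ : Tendsto (fun z : ℕ × Ω => (√(z.1 : ℝ))⁻¹) (probFilter P) (𝓝 0) :=
    (tendsto_inv_atTop_zero.comp (Real.tendsto_sqrt_atTop.comp tendsto_natCast_atTop_atTop)).comp
      (tendsto_fst_probFilter P)
  have h1 := (h.smul_tendsto_zero hρ).add_const a
  rw [zero_add] at h1
  refine h1.congr' ?_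
  filter_upwards [(tendsto_fst_probFilter P).eventually (eventually_gt_atTop 0)] with z hz
  have : √(z.1 : ℝ) ≠ 0 := (Real.sqrt_pos.2 (Nat.cast_pos.2 hz)).ne'
  rw [smul_smul, inv_mul_cancel₀ this, one_smul, sub_add_cancel]

/-- The delta method. -/
theorem tendsto_delta {E F : Type*} [NormedAddCommGroup E] [NormedSpace ℝ E]
    [NormedAddCommGroup F] [NormedSpace ℝ F] {P : Measure Ω} {Y : ℕ → Ω → E} {a : E} {s : Set E}
    {f : E → F} {D : E →L[ℝ] F} (hf : HasFDerivWithinAt f D s a) (hYs : ∀ n ω, Y n ω ∈ s)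
    (h : BddInProb P fun n ω => √(n : ℝ) • (Y n ω - a)) :
    Tendsto (fun z : ℕ × Ω => √(z.1 : ℝ) • (f (Y z.1 z.2) - f a)
      - D (√(z.1 : ℝ) • (Y z.1 z.2 - a))) (probFilter P) (𝓝 0) := by
  have hY : Tendsto (fun z : ℕ × Ω => Y z.1 z.2) (probFilter P) (𝓝[s] a) :=
    tendsto_nhdsWithin_iff.2 ⟨tendsto_of_bddInProb_sqrt h, Eventually.of_forall fun _ => hYs _ _⟩
  -- The ratio of the linearization remainder to `‖Y - a‖` tends to zero in probability, and
  -- multiplied by the bounded `√n (Y - a)` it has the norm of the scaled remainder. When `Y = a`,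
  -- the ratio is `0 / 0 = 0` and the remainder vanishes too.
  have hρ := (hf.isLittleO.norm_norm.tendsto_div_nhds_zero).comp hY
  refine tendsto_zero_iff_norm_tendsto_zero.2 ((tendsto_zero_iff_norm_tendsto_zero.1
    (h.smul_tendsto_zero hρ)).congr fun z => ?_)
  simp only [Function.comp_apply, norm_smul, Real.norm_eq_abs, map_smul, ← smul_sub,
    abs_div, abs_norm]
  by_cases h0 : ‖Y z.1 z.2 - a‖ = 0
  · have : Y z.1 z.2 = a := sub_eq_zero.1 (norm_eq_zero.1 h0)
    simp [this]
  · field_simp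

/-! ### Tightness and reduction to one-dimensional projections. -/

/-- Pointwise convergence of characteristic functions to a limit continuous at the origin gives
tightness, which is a uniform tail bound on the norms. -/
theorem bddInProb_of_tendstoInDistribution {Ω' : Type*} [MeasurableSpace Ω'] {P : Measure Ω}
    [IsProbabilityMeasure P] {P' : Measure Ω'} [IsProbabilityMeasure P'] {E : Type*}
    [NormedAddCommGroup E] [InnerProductSpace ℝ E] [FiniteDimensional ℝ E] [MeasurableSpace E]
    [BorelSpace E] {X : ℕ → Ω → E} {Z : Ω' → E}
    (h : TendstoInDistribution X atTop Z (fun _ => P) P') : BddInProb P X := by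
  have hmeas := h.forall_aemeasurable
  have hprob : ∀ n, IsProbabilityMeasure (P.map (X n)) := fun n =>
    Measure.isProbabilityMeasure_map (hmeas n)
  have hprob' : IsProbabilityMeasure (P'.map Z) :=
    Measure.isProbabilityMeasure_map h.aemeasurable_limit
  have htight := isTightMeasureSet_of_tendsto_charFun (μ := fun n => P.map (X n))
    (f := charFun (P'.map Z)) (by fun_prop)
    fun t => ProbabilityMeasure.tendsto_iff_tendsto_charFun.1 h.tendsto t
  intro ε hε
  obtain ⟨M, hM⟩ := ((tendsto_measure_norm_gt_of_isTightMeasureSet htight).eventually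
    (gt_mem_nhds hε)).exists
  refine ⟨M, Eventually.of_forall fun n => ?_⟩
  have h1 : P.map (X n) {x | M < ‖x‖} ≤ ε :=
    (le_iSup₂ (f := fun (μ : Measure E) (_ : μ ∈ Set.range fun n => P.map (X n)) =>
      μ {x | M < ‖x‖}) _ ⟨n, rfl⟩).trans hM.le
  rwa [Measure.map_apply_of_aemeasurable (hmeas n)
    (measurableSet_lt measurable_const measurable_norm)] at h1

theorem charFun_map_inner {E : Type*} [NormedAddCommGroup E] [InnerProductSpace ℝ E]
    [SecondCountableTopology E] [MeasurableSpace E] [BorelSpace E] {P : Measure Ω} {Y : Ω → E}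
    (hY : AEMeasurable Y P) (t : E) :
    charFun (P.map fun ω => inner ℝ (Y ω) t) 1 = charFun (P.map Y) t := by
  rw [charFun_apply, charFun_apply, integral_map (by fun_prop) (by fun_prop),
    integral_map hY (by fun_prop)]
  simp

/-- The Cramér–Wold device. -/
theorem tendstoInDistribution_of_inner {Ω' : Type*} [MeasurableSpace Ω'] {P : Measure Ω}
    [IsProbabilityMeasure P] {P' : Measure Ω'} [IsProbabilityMeasure P'] {E : Type*}
    [NormedAddCommGroup E] [InnerProductSpace ℝ E] [FiniteDimensional ℝ E] [MeasurableSpace E]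
    [BorelSpace E] {X : ℕ → Ω → E} {Z : Ω' → E} (hX : ∀ n, AEMeasurable (X n) P)
    (hZ : AEMeasurable Z P')
    (h : ∀ t, TendstoInDistribution (fun n ω => inner ℝ (X n ω) t) atTop
      (fun ω => inner ℝ (Z ω) t) (fun _ => P) P') :
    TendstoInDistribution X atTop Z (fun _ => P) P' where
  forall_aemeasurable := hX
  aemeasurable_limit := hZ
  tendsto := by
    refine ProbabilityMeasure.tendsto_iff_tendsto_charFun.2 fun t => ?_
    have h1 := ProbabilityMeasure.tendsto_iff_tendsto_charFun.1 (h t).tendsto 1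
    simp only [ProbabilityMeasure.coe_mk] at h1 ⊢
    rw [charFun_map_inner hZ] at h1
    exact h1.congr fun n => charFun_map_inner (hX n) t

end Prob

/-! ### The central limit theorem for the empirical p.m.f. -/

section CLT

variable {Ω : Type*} [MeasurableSpace Ω] {R S : ℕ}

/-- The sample space is finite for each `n`, so the estimator and the limit of the fitting procedure
need no measurability argument of their own. -/
theorem measurable_comp_sample {XY : ℕ → Ω → Cell R S} (hXY : ∀ k, Measurable (XY k)) {n : ℕ}
    {E : Type*} [MeasurableSpace E] (F : (Fin n → Cell R S) → E) :
    Measurable fun ω => F (sample XY n ω) :=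
  (measurable_of_finite F).comp (measurable_pi_lambda _ fun k => hXY k)

theorem sum_mul_vec_empPmf {n : ℕ} (x : Fin n → Cell R S) (f : Cell R S → ℝ) :
    ∑ c, f c * vec (empPmf x) c = (n : ℝ)⁻¹ * ∑ k, f (x k) := by
  simp only [vec, empPmf, Matrix.of_apply, Finset.mul_sum, Prod.mk.eta]
  rw [Finset.sum_comm]
  refine Finset.sum_congr rfl fun k _ => ?_
  rw [Finset.sum_eq_single (x k)]
  · simp [mul_comm]
  · intro c _ hc
    simp [hc.symm]
  · simp

theorem sum_mul_sqrt_smul_empPmf_sub {Ω : Type*} {XY : ℕ → Ω → Cell R S} {p : Table R S}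
    (f : Cell R S → ℝ) (n : ℕ) (ω : Ω) :
    ∑ c, f c * (√(n : ℝ) • vec (empPmf (sample XY n ω) - p)) c
      = (√(n : ℝ))⁻¹ * (∑ k ∈ Finset.range n, f (XY k ω) - n * ∑ c, f c * vec p c) := by
  have h1 : ∑ c, f c * (√(n : ℝ) • vec (empPmf (sample XY n ω) - p)) c
      = √(n : ℝ) * (∑ c, f c * vec (empPmf (sample XY n ω)) c - ∑ c, f c * vec p c) := by
    rw [← Finset.sum_sub_distrib, Finset.mul_sum]
    refine Finset.sum_congr rfl fun c _ => ?_
    simp only [Pi.smul_apply, smul_eq_mul, vec, Matrix.sub_apply]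
    ring
  rw [h1, sum_mul_vec_empPmf, ← Fin.sum_univ_eq_sum_range (fun k => f (XY k ω))]
  -- For `n = 0` both sides vanish, since `√0` and its inverse are zero.
  rcases Nat.eq_zero_or_pos n with rfl | hn
  · simp
  · have hn0 : (0 : ℝ) < n := Nat.cast_pos.2 hn
    have hs := Real.sq_sqrt hn0.le
    have hs0 := Real.sqrt_pos.2 hn0
    simp only [sample]
    field_simp
    rw [hs]

variable {P : Measure Ω} [IsProbabilityMeasure P]

theorem integral_comp_eq_sum {X : Ω → Cell R S} (hX : Measurable X) {p : Table R S}
    (hlaw : ∀ i j, P.real (X ⁻¹' {(i, j)}) = p i j) (f : Cell R S → ℝ) :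
    ∫ ω, f (X ω) ∂P = ∑ c, f c * vec p c := by
  have : IsProbabilityMeasure (P.map X) := Measure.isProbabilityMeasure_map hX.aemeasurable
  rw [← integral_map hX.aemeasurable (measurable_of_finite f).aestronglyMeasurable,
    integral_fintype Integrable.of_finite]
  refine Finset.sum_congr rfl fun c _ => ?_
  rw [map_measureReal_apply hX (measurableSet_singleton c), hlaw, smul_eq_mul, mul_comm]
  rfl

/-- `Σ_p` is the covariance matrix of the vector of cell indicators. Besides the limiting variance,
this supplies the nonnegativity of the eigenvalues. -/
theorem variance_comp_eq {X : Ω → Cell R S} (hX : Measurable X) {p : Table R S}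
    (hlaw : ∀ i j, P.real (X ⁻¹' {(i, j)}) = p i j) (f : Cell R S → ℝ) :
    Var[fun ω => f (X ω); P] = f ⬝ᵥ (multinomialCov p).mulVec f := by
  have hm : Measurable f := measurable_of_finite f
  have hbdd : MemLp (fun ω => f (X ω)) 2 P :=
    MemLp.of_bound (hm.comp hX).aestronglyMeasurable (∑ c, |f c|)
      (Eventually.of_forall fun ω => Finset.single_le_sum (f := fun c => |f c|)
        (fun _ _ => abs_nonneg _) (Finset.mem_univ _))
  rw [variance_eq_sub hbdd, integral_comp_eq_sum hX hlaw]
  have h2 := integral_comp_eq_sum hX hlaw fun c => f c ^ 2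
  simp only [Pi.pow_apply]
  rw [h2, multinomialCov, Matrix.sub_mulVec, dotProduct_sub, Matrix.vecMulVec_mulVec]
  congr 1
  · simp only [dotProduct, Matrix.mulVec_diagonal]
    exact Finset.sum_congr rfl fun c _ => by ring
  · rw [dotProduct_smul, MulOpposite.smul_eq_mul_unop, MulOpposite.unop_op, sq,
      dotProduct_comm (vec p) f]
    rfl

theorem tendstoInDistribution_sum_empPmf {XY : ℕ → Ω → Cell R S} {p : Table R S}
    (hXY : ∀ k, Measurable (XY k)) (hindep : iIndepFun XY P)
    (hlaw : ∀ k i j, P.real (XY k ⁻¹' {(i, j)}) = p i j) (f : Cell R S → ℝ)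
    {Ω' : Type*} [MeasurableSpace Ω'] {P' : Measure Ω'} [IsProbabilityMeasure P'] {Z : Ω' → ℝ}
    (hZ : HasLaw Z (gaussianReal 0 (f ⬝ᵥ (multinomialCov p).mulVec f).toNNReal) P') :
    TendstoInDistribution
      (fun (n : ℕ) ω => ∑ c, f c * (√(n : ℝ) • vec (empPmf (sample XY n ω) - p)) c) atTop Z
      (fun _ => P) P' := by
  have hm : Measurable f := measurable_of_finite f
  have hident : ∀ k, IdentDistrib (XY k) (XY 0) P P := fun k => by
    refine ⟨(hXY k).aemeasurable, (hXY 0).aemeasurable, ?_⟩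
    have h1 : IsProbabilityMeasure (P.map (XY k)) :=
      Measure.isProbabilityMeasure_map (hXY k).aemeasurable
    have h2 : IsProbabilityMeasure (P.map (XY 0)) :=
      Measure.isProbabilityMeasure_map (hXY 0).aemeasurable
    refine Measure.ext_of_measureReal_singleton fun c => ?_
    rw [map_measureReal_apply (hXY k) (measurableSet_singleton c),
      map_measureReal_apply (hXY 0) (measurableSet_singleton c), hlaw, hlaw]
  have hbdd : MemLp (fun ω => f (XY 0 ω)) 2 P :=
    MemLp.of_bound (hm.comp (hXY 0)).aestronglyMeasurable (∑ c, |f c|)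
      (Eventually.of_forall fun ω => Finset.single_le_sum (f := fun c => |f c|)
        (fun _ _ => abs_nonneg _) (Finset.mem_univ _))
  have h := tendstoInDistribution_inv_sqrt_mul_sum_sub (P := P) (P' := P')
    (X := fun k ω => f (XY k ω)) (Y := Z)
    (by rwa [variance_comp_eq (hXY 0) (hlaw 0)]) hbdd (hindep.comp (fun _ => f) fun _ => hm)
    (fun k => (hident k).comp hm)
  simp only [sum_mul_sqrt_smul_empPmf_sub]
  simpa only [integral_comp_eq_sum (hXY 0) (hlaw 0)] using h

/-- The product of standard normal laws is the standard Gaussian on Euclidean space, whose image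
under a linear form is centred with variance the squared norm of the form. -/
theorem hasLaw_sum_mul_gaussian {ι : Type*} [Fintype ι] (a : ι → ℝ) :
    HasLaw (fun z : ι → ℝ => ∑ i, z i * a i) (gaussianReal 0 (∑ i, a i ^ 2).toNNReal)
      (Measure.pi fun _ => gaussianReal 0 1) := by
  classical
  set s : EuclideanSpace ℝ ι := WithLp.toLp 2 a
  have h := IsGaussian.map_eq_gaussianReal (μ := stdGaussian (EuclideanSpace ℝ ι)) (innerSL ℝ s)
  rw [integral_strongDual_stdGaussian, variance_dual_stdGaussian, innerSL_apply_norm,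
    EuclideanSpace.real_norm_sq_eq, ← map_pi_eq_stdGaussian,
    Measure.map_map (by fun_prop) (by fun_prop)] at h
  have hm : Measurable fun z : ι → ℝ => ∑ i, z i * a i := by fun_prop
  refine ⟨hm.aemeasurable, ?_⟩
  rw [← h]
  congr 1

/-- The central limit theorem for linear images of the empirical p.m.f. whose limiting covariance
matrix is diagonal. -/
theorem tendstoInDistribution_mulVec_empPmf {XY : ℕ → Ω → Cell R S} {p : Table R S}
    (hXY : ∀ k, Measurable (XY k)) (hindep : iIndepFun XY P)
    (hlaw : ∀ k i j, P.real (XY k ⁻¹' {(i, j)}) = p i j) {ι : Type*} [Fintype ι] [DecidableEq ι]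
    (B : Matrix ι (Cell R S) ℝ) {d : ι → ℝ} (hd : ∀ i, 0 ≤ d i)
    (hB : B * multinomialCov p * B.transpose = Matrix.diagonal d) :
    TendstoInDistribution
      (fun (n : ℕ) ω => WithLp.toLp 2 (B.mulVec (√(n : ℝ) • vec (empPmf (sample XY n ω) - p))))
      atTop (fun z : ι → ℝ => WithLp.toLp 2 fun i => √(d i) * z i)
      (fun _ => P) (Measure.pi fun _ => gaussianReal 0 1) := by
  have hZm : Measurable fun (z : ι → ℝ) i => √(d i) * z i := by fun_prop
  refine tendstoInDistribution_of_inner (fun n => ?_)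
    ((WithLp.measurable_toLp 2 (ι → ℝ)).comp hZm).aemeasurable fun t => ?_
  · exact (measurable_comp_sample hXY fun x =>
      WithLp.toLp 2 (B.mulVec (√(n : ℝ) • vec (empPmf x - p)))).aemeasurable
  have h1 : ∀ w : Cell R S → ℝ, inner ℝ (WithLp.toLp 2 (B.mulVec w)) t
      = ∑ c, (B.transpose.mulVec t.ofLp) c * w c := fun w => by
    rw [EuclideanSpace.inner_eq_star_dotProduct]
    change t.ofLp ⬝ᵥ B.mulVec w = B.transpose.mulVec t.ofLp ⬝ᵥ w
    rw [Matrix.dotProduct_mulVec, Matrix.mulVec_transpose]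
  simp only [h1]
  refine tendstoInDistribution_sum_empPmf hXY hindep hlaw _ ?_
  -- Diagonality of `B Σ_p Bᵀ` makes the variance of the projection on `t` equal to that of the same
  -- projection of the independent coordinates `√d_i z_i`.
  have h2 : B.transpose.mulVec t.ofLp ⬝ᵥ (multinomialCov p).mulVec (B.transpose.mulVec t.ofLp)
      = ∑ i, (√(d i) * t i) ^ 2 := by
    rw [Matrix.mulVec_transpose, ← Matrix.dotProduct_mulVec, ← Matrix.mulVec_transpose,
      Matrix.mulVec_mulVec, Matrix.mulVec_mulVec, hB]
    simp only [dotProduct, Matrix.mulVec_diagonal, mul_pow, Real.sq_sqrt (hd _)]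
    exact Finset.sum_congr rfl fun i _ => by ring
  rw [h2]
  refine (hasLaw_sum_mul_gaussian fun i => √(d i) * t i).congr (Eventually.of_forall fun z => ?_)
  change inner ℝ (WithLp.toLp 2 fun i => √(d i) * z i) t = _
  rw [EuclideanSpace.inner_eq_star_dotProduct]
  simp only [dotProduct, Pi.star_apply, star_trivial]
  exact Finset.sum_congr rfl fun i _ => by ring

theorem bddInProb_empPmf {XY : ℕ → Ω → Cell R S} {p : Table R S}
    (hXY : ∀ k, Measurable (XY k)) (hindep : iIndepFun XY P)
    (hlaw : ∀ k i j, P.real (XY k ⁻¹' {(i, j)}) = p i j) :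
    BddInProb P fun n ω => √(n : ℝ) • vec (empPmf (sample XY n ω) - p) := by
  refine bddInProb_pi fun c => ?_
  have h := bddInProb_of_tendstoInDistribution (tendstoInDistribution_sum_empPmf hXY hindep hlaw
    (Pi.single c 1) (Z := id) (P' := gaussianReal 0 _) HasLaw.id)
  simpa [Pi.single_apply] using h

end CLT

/-! ### The smoothed empirical p.m.f. and the empirical copula p.m.f. -/

theorem sum_sum_count {R S n : ℕ} (x : Fin n → Cell R S) :
    ∑ i, ∑ j, ∑ k, (if x k = (i, j) then (1 : ℝ) else 0) = n := by
  rw [← Fintype.sum_prod_type' (fun i j => ∑ k, if x k = (i, j) then (1 : ℝ) else 0),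
    Finset.sum_comm]
  simp

theorem smoothPmf_mem_posPmf {R S n : ℕ} (x : Fin n → Cell R S) : smoothPmf x ∈ posPmf R S := by
  refine ⟨fun i j => ?_, ?_⟩
  · have : (0 : ℝ) ≤ ∑ k, if x k = (i, j) then (1 : ℝ) else 0 :=
      Finset.sum_nonneg fun k _ => by split_ifs <;> norm_num
    simp only [smoothPmf, Matrix.of_apply]
    positivity
  · simp only [smoothPmf, Matrix.of_apply, ← Finset.mul_sum, Finset.sum_add_distrib,
      sum_sum_count]
    have h1 : (R : ℝ) + 1 ≠ 0 := by positivity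
    have h2 : (S : ℝ) + 1 ≠ 0 := by positivity
    have h3 : (n : ℝ) + 1 ≠ 0 := by positivity
    simp
    field_simp

/-- Needed because `J_{u,p}` represents the derivative of `𝒰` only on vectors of total mass zero.
The factor `√n` covers `n = 0`, where the empirical table is zero. -/
theorem sum_sqrt_smul_empPmf_sub {R S n : ℕ} (x : Fin n → Cell R S) {p : Table R S}
    (hp : p ∈ posPmf R S) : ∑ c, (√(n : ℝ) • vec (empPmf x - p)) c = 0 := by
  have h1 : ∑ c, vec (empPmf x) c = (n : ℝ)⁻¹ * n := by
    simpa using sum_mul_vec_empPmf x fun _ => 1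
  have h2 : ∑ c, vec p c = 1 := by
    rw [Fintype.sum_prod_type]
    exact hp.2
  have h3 : ∀ c, (√(n : ℝ) • vec (empPmf x - p)) c
      = √(n : ℝ) * (vec (empPmf x) c - vec p c) := fun c => rfl
  simp only [h3]
  rw [← Finset.mul_sum, Finset.sum_sub_distrib, h1, h2]
  rcases Nat.eq_zero_or_pos n with rfl | hn
  · simp
  · rw [inv_mul_cancel₀ (Nat.cast_ne_zero.2 hn.ne'), sub_self, mul_zero]

/-- The smoothed p.m.f. mixes the empirical and uniform ones with weights `n/(n+1)` and `1/(n+1)`.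
The last two terms are negligible, so smoothing does not affect the limit. -/
theorem sqrt_smul_smoothPmf_sub {R S n : ℕ} (x : Fin n → Cell R S) (p : Table R S) :
    √(n : ℝ) • (vec (smoothPmf x) - vec p)
      = √(n : ℝ) • vec (empPmf x - p)
        + (-((n : ℝ) + 1)⁻¹) • (√(n : ℝ) • vec (empPmf x - p))
        + (√(n : ℝ) * ((n : ℝ) + 1)⁻¹) •
          fun c => 1 / (((R : ℝ) + 1) * ((S : ℝ) + 1)) - vec p c := by
  ext c
  simp only [vec, smoothPmf, empPmf, Matrix.of_apply, Pi.smul_apply, Pi.sub_apply, Pi.add_apply,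
    Matrix.sub_apply, smul_eq_mul]
  rcases Nat.eq_zero_or_pos n with rfl | hn
  · simp
  · have h0 : (n : ℝ) ≠ 0 := Nat.cast_ne_zero.2 hn.ne'
    have h1 : (n : ℝ) + 1 ≠ 0 := by positivity
    generalize (∑ k, if x k = (c.1, c.2) then (1 : ℝ) else 0) = N
    generalize 1 / (((R : ℝ) + 1) * ((S : ℝ) + 1)) = κ
    field_simp
    ring

theorem tendsto_inv_add_one_nat : Tendsto (fun n : ℕ => ((n : ℝ) + 1)⁻¹) atTop (𝓝 0) := by
  simpa [one_div] using tendsto_one_div_add_atTop_nhds_zero_nat (𝕜 := ℝ)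

theorem tendsto_sqrt_mul_inv_add_one_nat :
    Tendsto (fun n : ℕ => √(n : ℝ) * ((n : ℝ) + 1)⁻¹) atTop (𝓝 0) := by
  have h : Tendsto (fun n : ℕ => (√(n : ℝ))⁻¹) atTop (𝓝 0) :=
    tendsto_inv_atTop_zero.comp (Real.tendsto_sqrt_atTop.comp tendsto_natCast_atTop_atTop)
  refine squeeze_zero' (Eventually.of_forall fun n => by positivity) ?_ h
  filter_upwards [eventually_gt_atTop 0] with n hn
  have h0 : (0 : ℝ) < n := Nat.cast_pos.2 hn
  have hs := Real.sqrt_pos.2 h0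
  rw [← div_eq_mul_inv, div_le_iff₀ (by positivity), inv_mul_eq_div, le_div_iff₀ hs,
    Real.mul_self_sqrt h0.le]
  linarith

section Asymptotics

variable {Ω : Type*} [MeasurableSpace Ω] {P : Measure Ω} {R S m q : ℕ} {p : Table R S}
  {XY : ℕ → Ω → Cell R S}

theorem tendsto_smoothPmf_sub_empPmf
    (hZ : BddInProb P fun n ω => √(n : ℝ) • vec (empPmf (sample XY n ω) - p)) :
    Tendsto (fun z : ℕ × Ω => √(z.1 : ℝ) • (vec (smoothPmf (sample XY z.1 z.2)) - vec p)
      - √(z.1 : ℝ) • vec (empPmf (sample XY z.1 z.2) - p)) (probFilter P) (𝓝 0) := by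
  have h1 := hZ.smul_tendsto_zero
    ((neg_zero (G := ℝ) ▸ tendsto_inv_add_one_nat.neg).comp (tendsto_fst_probFilter P))
  have h2 := (tendsto_sqrt_mul_inv_add_one_nat.comp (tendsto_fst_probFilter P)).smul_const
    fun c => 1 / (((R : ℝ) + 1) * ((S : ℝ) + 1)) - vec p c
  have h3 := h1.add h2
  rw [zero_smul, add_zero] at h3
  refine h3.congr fun z => ?_
  rw [sqrt_smul_smoothPmf_sub, add_assoc, add_sub_cancel_left]
  rfl

theorem bddInProb_smoothPmf
    (hZ : BddInProb P fun n ω => √(n : ℝ) • vec (empPmf (sample XY n ω) - p)) :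
    BddInProb P fun n ω => √(n : ℝ) • (vec (smoothPmf (sample XY n ω)) - vec p) := by
  simpa using (bddInProb_of_tendsto
    (X := fun n ω => √(n : ℝ) • (vec (smoothPmf (sample XY n ω)) - vec p)
      - √(n : ℝ) • vec (empPmf (sample XY n ω) - p)) (tendsto_smoothPmf_sub_empPmf hZ)).add hZ

/-- Asymptotic linearity of the empirical copula p.m.f. -/
theorem tendsto_empCopula (hp : p ∈ posPmf R S)
    (hZ : BddInProb P fun n ω => √(n : ℝ) • vec (empPmf (sample XY n ω) - p)) :
    Tendsto (fun z : ℕ × Ω =>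
      √(z.1 : ℝ) • (vec (empCopula (sample XY z.1 z.2)) - vec (ipfpUnif p))
        - (matJ (ipfpUnif p) p).mulVec (√(z.1 : ℝ) • vec (empPmf (sample XY z.1 z.2) - p)))
      (probFilter P) (𝓝 0) := by
  obtain ⟨D, hD, hDJ⟩ := exists_hasFDerivWithinAt_ipfpUnif hp
  have h1 := tendsto_delta (Y := fun n ω => vec (smoothPmf (sample XY n ω))) hD
    (fun n ω => smoothPmf_mem_posPmf (sample XY n ω)) (bddInProb_smoothPmf hZ)
  -- The delta method uses the smoothed p.m.f., which always lies in the domain of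
  -- differentiability; this step puts the empirical p.m.f. into the linear term.
  have h2 := (D.continuous.tendsto 0).comp (tendsto_smoothPmf_sub_empPmf hZ)
  rw [map_zero] at h2
  have h3 := h1.add h2
  rw [add_zero] at h3
  refine h3.congr fun z => ?_
  simp only [Function.comp_apply]
  rw [map_sub, sub_add_sub_cancel, hDJ _ (sum_sqrt_smul_empPmf_sub _ hp)]
  rfl

theorem hasFDerivAt_vec_family {u : EuclideanSpace ℝ (Fin m) → Table R S}
    {θ₀ : EuclideanSpace ℝ (Fin m)} (hdiff : ∀ i j, DifferentiableAt ℝ (fun θ => u θ i j) θ₀) :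
    HasFDerivAt (fun θ => vec (u θ))
      ((mulVecCLM (jacobian u θ₀)).comp (EuclideanSpace.equiv (Fin m) ℝ).toContinuousLinearMap)
      θ₀ := by
  refine hasFDerivAt_pi'.2 fun c => (hdiff c.1 c.2).hasFDerivAt.congr_fderiv ?_
  refine ContinuousLinearMap.ext fun x => ?_
  have hx : x = ∑ k, x k • EuclideanSpace.single k (1 : ℝ) := by
    ext i
    simp [Pi.single_apply]
  conv_lhs => rw [hx, map_sum]
  simp only [map_smul, smul_eq_mul]
  change _ = ∑ k, jacobian u θ₀ c k * x k
  exact Finset.sum_congr rfl fun k _ => mul_comm _ _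

/-- The asymptotic expansion of the difference between the empirical copula p.m.f. and the fitted
one. -/
theorem tendsto_empCopula_sub_family (hp : p ∈ posPmf R S)
    (hZ : BddInProb P fun n ω => √(n : ℝ) • vec (empPmf (sample XY n ω) - p))
    {u : EuclideanSpace ℝ (Fin m) → Table R S} {θ₀ : EuclideanSpace ℝ (Fin m)}
    (hH₀ : ipfpUnif p = u θ₀) (hdiff : ∀ i j, DifferentiableAt ℝ (fun θ => u θ i j) θ₀)
    {T : ℕ → Ω → EuclideanSpace ℝ (Fin m)} (hT : BddInProb P fun n ω => √(n : ℝ) • (T n ω - θ₀))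
    {W : Matrix (Fin m) (Cell R S) ℝ}
    (hV : Tendsto (fun z : ℕ × Ω => √(z.1 : ℝ) • (T z.1 z.2 - θ₀) - WithLp.toLp 2
      (W.mulVec (√(z.1 : ℝ) • vec (empPmf (sample XY z.1 z.2) - p)))) (probFilter P) (𝓝 0)) :
    Tendsto (fun z : ℕ × Ω =>
      √(z.1 : ℝ) • vec (empCopula (sample XY z.1 z.2) - u (T z.1 z.2))
        - (matJ (ipfpUnif p) p - jacobian u θ₀ * W).mulVec
          (√(z.1 : ℝ) • vec (empPmf (sample XY z.1 z.2) - p))) (probFilter P) (𝓝 0) := by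
  have h1 := tendsto_empCopula hp hZ
  have h2 := tendsto_delta (hasFDerivAt_vec_family hdiff).hasFDerivWithinAt
    (fun n ω => Set.mem_univ (T n ω)) hT
  have h3 := (((mulVecCLM (jacobian u θ₀)).comp
    (EuclideanSpace.equiv (Fin m) ℝ).toContinuousLinearMap).continuous.tendsto 0).comp hV
  rw [map_zero] at h3
  -- Subtracting the expansion of the fitted family from that of `uⁿ` cancels the common centre
  -- `𝒰(p) = u^θ₀`.
  have h4 := h1.sub (h2.add h3)
  rw [add_zero, sub_zero] at h4
  refine h4.congr fun z => ?_
  simp only [Function.comp_apply]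
  rw [map_sub, sub_add_sub_cancel, hH₀, Matrix.sub_mulVec, ← Matrix.mulVec_mulVec]
  change _ = √(z.1 : ℝ) • (vec (empCopula (sample XY z.1 z.2)) - vec (u (T z.1 z.2))) - _
  rw [sub_sub_sub_comm, ← smul_sub, sub_sub_sub_cancel_right]
  rfl

end Asymptotics

/-! ### The quadratic form -/

theorem exists_diagonalization {ι : Type*} [Fintype ι] [DecidableEq ι] {A : Matrix ι ι ℝ}
    (hA : A.IsHermitian) :
    ∃ Q : Matrix ι ι ℝ, Q.transpose * Q = 1 ∧
      Q * A * Q.transpose = Matrix.diagonal hA.eigenvalues := by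
  refine ⟨star (hA.eigenvectorUnitary : Matrix ι ι ℝ), ?_, ?_⟩
  · rw [Matrix.star_eq_conjTranspose, Matrix.conjTranspose_eq_transpose_of_trivial,
      Matrix.transpose_transpose, ← Matrix.conjTranspose_eq_transpose_of_trivial,
      ← Matrix.star_eq_conjTranspose]
    exact Unitary.coe_mul_star_self _
  · have h := hA.conjStarAlgAut_star_eigenvectorUnitary
    rw [Unitary.conjStarAlgAut_star_apply] at h
    rw [Matrix.star_eq_conjTranspose, Matrix.conjTranspose_eq_transpose_of_trivial,
      Matrix.transpose_transpose, ← Matrix.conjTranspose_eq_transpose_of_trivial,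
      ← Matrix.star_eq_conjTranspose]
    exact h

theorem norm_toLp_mulVec_of_orthogonal {ι : Type*} [Fintype ι] [DecidableEq ι] {Q : Matrix ι ι ℝ}
    (hQ : Q.transpose * Q = 1) (w : ι → ℝ) :
    ‖WithLp.toLp 2 (Q.mulVec w)‖ ^ 2 = ‖WithLp.toLp 2 w‖ ^ 2 := by
  have h : ∀ v : ι → ℝ, ‖WithLp.toLp 2 v‖ ^ 2 = v ⬝ᵥ v := fun v => by
    rw [EuclideanSpace.real_norm_sq_eq]
    simp [dotProduct, sq]
  rw [h, h, Matrix.dotProduct_mulVec, ← Matrix.mulVec_transpose, Matrix.mulVec_mulVec, hQ,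
    Matrix.one_mulVec]

/-- Every group contains a cell, so its mass is positive and the inverse square root is continuous
there. -/
theorem mulVec_vec_pos {R S q : ℕ} {G : Matrix (Fin q) (Cell R S) ℝ} (hG : IsGroupingMatrix G)
    {v : Table R S} (hv : v ∈ posPmf R S) (a : Fin q) : 0 < G.mulVec (vec v) a := by
  obtain ⟨c, hc⟩ := hG.row a
  have h0 : ∀ c, 0 ≤ G a c * vec v c := fun c =>
    mul_nonneg (by rcases hG.zero_or_one a c with h | h <;> simp [h]) (hv.1 _ _).le
  refine Finset.sum_pos' (fun c _ => h0 c) ⟨c, Finset.mem_univ c, ?_⟩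
  change 0 < G a c * vec v c
  rw [hc, one_mul]
  exact hv.1 _ _

/-- Writing `D_x` for the random diagonal matrix and `D` for its limit, `D_x w - D y = D_x (w - y) +
(D_x - D) y`. The hypothesis on `y` is the form in which boundedness in probability enters. -/
theorem tendsto_invSqrtDiag {α : Type*} {l : Filter α} {R S q : ℕ}
    {G : Matrix (Fin q) (Cell R S) ℝ} (hG : IsGroupingMatrix G) {f : α → Table R S}
    {v : Table R S} (hv : v ∈ posPmf R S) (hf : Tendsto (fun x => vec (f x)) l (𝓝 (vec v)))
    {w : α → Fin q → ℝ} {y : α → Fin q → ℝ}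
    (hw : Tendsto (fun x => w x - y x) l (𝓝 0))
    (hy : ∀ ρ : α → ℝ, Tendsto ρ l (𝓝 0) → ∀ a, Tendsto (fun x => ρ x * y x a) l (𝓝 0)) :
    Tendsto (fun x => (invSqrtDiag G (f x)).mulVec (w x) - (invSqrtDiag G v).mulVec (y x)) l
      (𝓝 0) := by
  refine tendsto_pi_nhds.2 fun a => ?_
  have h1 : Tendsto (fun x => (√(G.mulVec (vec (f x)) a))⁻¹) l
      (𝓝 (√(G.mulVec (vec v) a))⁻¹) := by
    have hc : Tendsto (fun x => G.mulVec (vec (f x)) a) l (𝓝 (G.mulVec (vec v) a)) :=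
      (((continuous_apply a).comp (mulVecCLM G).continuous).tendsto (vec v)).comp hf
    exact hc.sqrt.inv₀ (Real.sqrt_pos.2 (mulVec_vec_pos hG hv a)).ne'
  have h2 := h1.sub_const (√(G.mulVec (vec v) a))⁻¹
  rw [sub_self] at h2
  have h3 := (h1.mul (tendsto_pi_nhds.1 hw a)).add (hy _ h2 a)
  simp only [Pi.zero_apply, mul_zero, add_zero] at h3
  refine h3.congr fun x => ?_
  simp only [Pi.sub_apply, invSqrtDiag, Matrix.mulVec_diagonal]
  ring

theorem limitCov_eq {R S m q : ℕ} (G : Matrix (Fin q) (Cell R S) ℝ)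
    (u : EuclideanSpace ℝ (Fin m) → Table R S)
    (V : EuclideanSpace ℝ (Fin m) → Table R S → Table R S → Matrix (Fin m) (Cell R S) ℝ)
    (θ : EuclideanSpace ℝ (Fin m)) (v p : Table R S) :
    limitCov G u V θ v p
      = (invSqrtDiag G (u θ) * G * (matJ v p - jacobian u θ * V θ v p)) * multinomialCov p
        * (invSqrtDiag G (u θ) * G * (matJ v p - jacobian u θ * V θ v p)).transpose := by
  simp only [limitCov, Matrix.transpose_mul, Matrix.mul_assoc]
  simp [invSqrtDiag]

theorem chiSquareStat_eq {R S n q : ℕ} (G : Matrix (Fin q) (Cell R S) ℝ) (x : Fin n → Cell R S)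
    (v : Table R S) :
    chiSquareStat G x v = ‖WithLp.toLp 2 ((invSqrtDiag G v).mulVec
      (G.mulVec (√(n : ℝ) • vec (empCopula x - v))))‖ ^ 2 := by
  rw [Matrix.mulVec_smul, Matrix.mulVec_smul, WithLp.toLp_smul, norm_smul, mul_pow,
    Real.norm_eq_abs, sq_abs, Real.sq_sqrt (Nat.cast_nonneg n)]
  rfl

theorem eigenvalues_nonneg_of_diagonal {Ω : Type*} [MeasurableSpace Ω] {P : Measure Ω}
    [IsProbabilityMeasure P] {R S : ℕ} {X : Ω → Cell R S} (hX : Measurable X) {p : Table R S}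
    (hlaw : ∀ i j, P.real (X ⁻¹' {(i, j)}) = p i j) {ι : Type*} [Fintype ι] [DecidableEq ι]
    {B : Matrix ι (Cell R S) ℝ} {d : ι → ℝ}
    (hB : B * multinomialCov p * B.transpose = Matrix.diagonal d) (i : ι) : 0 ≤ d i := by
  have h : d i = (fun c => B i c) ⬝ᵥ (multinomialCov p).mulVec fun c => B i c := by
    have h1 := congr_fun (congr_fun hB i) i
    rw [Matrix.diagonal_apply_eq, Matrix.mul_assoc, Matrix.mul_apply] at h1
    rw [← h1]
    rfl
  rw [h, ← variance_comp_eq hX hlaw]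
  exact variance_nonneg _ _

/-- Rotating by the transposed eigenvector matrix diagonalizes the limiting covariance without
changing the statistic, so the limit is read off from independent coordinates. -/
theorem tendstoInDistribution_chiSquareStat {Ω : Type*} [MeasurableSpace Ω] {P : Measure Ω}
    [IsProbabilityMeasure P] {R S q : ℕ} {p : Table R S} {XY : ℕ → Ω → Cell R S}
    (hXY : ∀ k, Measurable (XY k)) (hindep : iIndepFun XY P)
    (hlaw : ∀ k i j, P.real (XY k ⁻¹' {(i, j)}) = p i j)
    {v : (n : ℕ) → (Fin n → Cell R S) → Table R S} {v₀ : Table R S} (hv₀ : v₀ ∈ posPmf R S)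
    (hfit : Tendsto (fun z : ℕ × Ω => vec (v z.1 (sample XY z.1 z.2))) (probFilter P)
      (𝓝 (vec v₀)))
    {C : Matrix (Cell R S) (Cell R S) ℝ}
    (hexp : Tendsto (fun z : ℕ × Ω =>
      √(z.1 : ℝ) • vec (empCopula (sample XY z.1 z.2) - v z.1 (sample XY z.1 z.2))
        - C.mulVec (√(z.1 : ℝ) • vec (empPmf (sample XY z.1 z.2) - p))) (probFilter P) (𝓝 0))
    {G : Matrix (Fin q) (Cell R S) ℝ} (hG : IsGroupingMatrix G) {A : Matrix (Fin q) (Fin q) ℝ}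
    (hA : A.IsHermitian) (hAC : A = (invSqrtDiag G v₀ * G * C) * multinomialCov p
      * (invSqrtDiag G v₀ * G * C).transpose) :
    TendstoInDistribution (fun (n : ℕ) ω => chiSquareStat G (sample XY n ω) (v n (sample XY n ω)))
      atTop (fun z : Fin q → ℝ => ∑ k, hA.eigenvalues k * z k ^ 2)
      (fun _ => P) (Measure.pi fun _ => gaussianReal 0 1) := by
  have hZ := bddInProb_empPmf hXY hindep hlaw
  obtain ⟨Q, hQ, hQA⟩ := exists_diagonalization hA
  have hBcov : (Q * (invSqrtDiag G v₀ * G * C)) * multinomialCov p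
      * (Q * (invSqrtDiag G v₀ * G * C)).transpose = Matrix.diagonal hA.eigenvalues := by
    rw [← hQA, Matrix.transpose_mul]
    conv_rhs => rw [hAC]
    simp only [Matrix.mul_assoc]
  have hnn := eigenvalues_nonneg_of_diagonal (hXY 0) (hlaw 0) hBcov
  have hclt := tendstoInDistribution_mulVec_empPmf hXY hindep hlaw _ hnn hBcov
  have hGexp := ((mulVecCLM G).continuous.tendsto 0).comp hexp
  rw [map_zero] at hGexp
  have hquad := tendsto_invSqrtDiag hG hv₀ hfit
    (w := fun z : ℕ × Ω => G.mulVec (√(z.1 : ℝ) • vec (empCopula (sample XY z.1 z.2)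
      - v z.1 (sample XY z.1 z.2))))
    (y := fun z : ℕ × Ω => G.mulVec (C.mulVec
      (√(z.1 : ℝ) • vec (empPmf (sample XY z.1 z.2) - p))))
    (hGexp.congr fun z => by simp only [Function.comp_apply, map_sub, mulVecCLM_apply])
    (fun ρ hρ a => tendsto_pi_nhds.1 (((hZ.map (mulVecCLM C)).map
      (mulVecCLM G)).smul_tendsto_zero hρ) a)
  have hsub := (((EuclideanSpace.equiv (Fin q) ℝ).symm.toContinuousLinearMap.comp
    (mulVecCLM Q)).continuous.tendsto 0).comp hquad
  rw [map_zero] at hsub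
  -- Slutsky's lemma: the rotated, normalized vector differs by `o_P(1)` from a fixed linear image
  -- of `√n vec(p̂ⁿ - p)`.
  have hdist := tendstoInDistribution_of_tendstoInMeasure_sub
    (fun (n : ℕ) ω => WithLp.toLp 2 (Q.mulVec ((invSqrtDiag G (v n (sample XY n ω))).mulVec
      (G.mulVec (√(n : ℝ) • vec (empCopula (sample XY n ω) - v n (sample XY n ω))))))) _
    hclt (by
      refine tendstoInMeasure_iff_tendsto_probFilter.2 (hsub.congr fun z => ?_)
      simp only [Function.comp_apply, map_sub, Pi.sub_apply]
      rw [← Matrix.mulVec_mulVec, ← Matrix.mulVec_mulVec, ← Matrix.mulVec_mulVec]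
      rfl)
    fun n => (measurable_comp_sample hXY fun x => WithLp.toLp 2
      (Q.mulVec ((invSqrtDiag G (v n x)).mulVec
        (G.mulVec (√(n : ℝ) • vec (empCopula x - v n x)))))).aemeasurable
  have hfinal := hdist.continuous_comp (g := fun y : EuclideanSpace ℝ (Fin q) => ‖y‖ ^ 2)
    (by fun_prop)
  refine hfinal.congr (fun n => Eventually.of_forall fun ω => ?_)
    (Eventually.of_forall fun z => ?_)
  · simp only [Function.comp_apply]
    rw [norm_toLp_mulVec_of_orthogonal hQ, chiSquareStat_eq]
  · simp only [Function.comp_apply, EuclideanSpace.real_norm_sq_eq, mul_pow,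
      Real.sq_sqrt (hnn _)]

/-! ### Consistency of the plug-in quantities. -/

theorem tendsto_smoothPmf {Ω : Type*} [MeasurableSpace Ω] {P : Measure Ω} {R S : ℕ}
    {p : Table R S} {XY : ℕ → Ω → Cell R S}
    (hZ : BddInProb P fun n ω => √(n : ℝ) • vec (empPmf (sample XY n ω) - p)) :
    Tendsto (fun z : ℕ × Ω => smoothPmf (sample XY z.1 z.2)) (probFilter P) (𝓝 p) := by
  have := tendsto_of_bddInProb_sqrt (bddInProb_smoothPmf hZ)
  exact tendsto_pi_nhds.2 fun i => tendsto_pi_nhds.2 fun j => tendsto_pi_nhds.1 this (i, j)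

theorem tendsto_empCopula_ipfpUnif {Ω : Type*} [MeasurableSpace Ω] {P : Measure Ω} {R S : ℕ}
    {p : Table R S} (hp : p ∈ posPmf R S) {XY : ℕ → Ω → Cell R S}
    (hZ : BddInProb P fun n ω => √(n : ℝ) • vec (empPmf (sample XY n ω) - p)) :
    Tendsto (fun z : ℕ × Ω => empCopula (sample XY z.1 z.2)) (probFilter P)
      (𝓝 (ipfpUnif p)) := by
  have h1 : BddInProb P fun n ω =>
      √(n : ℝ) • (vec (empCopula (sample XY n ω)) - vec (ipfpUnif p)) := by
    simpa only [mulVecCLM_apply, sub_add_cancel] using (bddInProb_of_tendsto (X := fun n ω =>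
      √(n : ℝ) • (vec (empCopula (sample XY n ω)) - vec (ipfpUnif p))
        - (matJ (ipfpUnif p) p).mulVec (√(n : ℝ) • vec (empPmf (sample XY n ω) - p)))
      (tendsto_empCopula hp hZ)).add (hZ.map (mulVecCLM (matJ (ipfpUnif p) p)))
  have := tendsto_of_bddInProb_sqrt h1
  exact tendsto_pi_nhds.2 fun i => tendsto_pi_nhds.2 fun j => tendsto_pi_nhds.1 this (i, j)

theorem bddInProb_of_linear_expansion {Ω : Type*} [MeasurableSpace Ω] {P : Measure Ω} {R S m : ℕ}
    {Z : ℕ → Ω → Cell R S → ℝ} (hZ : BddInProb P Z) {W : Matrix (Fin m) (Cell R S) ℝ}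
    {X : ℕ → Ω → EuclideanSpace ℝ (Fin m)}
    (h : Tendsto (fun z : ℕ × Ω => X z.1 z.2 - WithLp.toLp 2 (W.mulVec (Z z.1 z.2)))
      (probFilter P) (𝓝 0)) : BddInProb P X := by
  have h1 := hZ.map ((EuclideanSpace.equiv (Fin m) ℝ).symm.toContinuousLinearMap.comp
    (mulVecCLM W))
  simpa using (bddInProb_of_tendsto
    (X := fun n ω => X n ω - WithLp.toLp 2 (W.mulVec (Z n ω))) h).add h1

end CopulaGOF

theorem proposition4p2
    {Ω : Type*} [MeasurableSpace Ω] (P : Measure Ω) [IsProbabilityMeasure P]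
    {R S m q : ℕ}
    -- the p.m.f. of `(X, Y)`, with rectangular support
    (p : Table R S) (hp : p ∈ posPmf R S)
    -- independent copies of `(X, Y)`
    (XY : ℕ → Ω → Cell R S) (hXY : ∀ k, Measurable (XY k)) (hindep : iIndepFun XY P)
    (hlaw : ∀ k i j, P.real (XY k ⁻¹' {(i, j)}) = p i j)
    -- the parametric family of copula p.m.f.s
    (Θ : Set (EuclideanSpace ℝ (Fin m))) (hΘ : IsOpen Θ)
    (u : EuclideanSpace ℝ (Fin m) → Table R S) (hu : ∀ θ ∈ Θ, u θ ∈ posCopulaPmf R S)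
    -- the null hypothesis: the copula p.m.f. of `p` is `u θ₀`
    (θ₀ : EuclideanSpace ℝ (Fin m)) (hθ₀ : θ₀ ∈ Θ) (hH₀ : ipfpUnif p = u θ₀)
    -- differentiability of the family at `θ₀`
    (hdiff : ∀ i j, DifferentiableAt ℝ (fun θ => u θ i j) θ₀)
    -- the estimator of `θ₀`, and its asymptotic linearity
    (θhat : (n : ℕ) → (Fin n → Cell R S) → EuclideanSpace ℝ (Fin m))
    (hθhat : ∀ n x, θhat n x ∈ Θ)
    (V : EuclideanSpace ℝ (Fin m) → Table R S → Table R S → Matrix (Fin m) (Cell R S) ℝ)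
    (hV : TendstoInMeasure P
      (fun (n : ℕ) ω => √(n : ℝ) • (θhat n (sample XY n ω) - θ₀)
        - WithLp.toLp 2 ((V θ₀ (ipfpUnif p) p).mulVec
            (√(n : ℝ) • vec (empPmf (sample XY n ω) - p))))
      atTop (fun _ => 0))
    -- the grouping matrix
    (G : Matrix (Fin q) (Cell R S) ℝ) (hG : IsGroupingMatrix G) :
    -- weak convergence of the statistic; the coordinates `z k` are i.i.d. `N(0,1)` under the
    -- product measure
    TendstoInDistribution
      (fun (n : ℕ) ω => chiSquareStat G (sample XY n ω) (u (θhat n (sample XY n ω))))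
      atTop
      (fun z : Fin q → ℝ =>
        ∑ k, (limitCov_isHermitian G u V θ₀ (ipfpUnif p) p).eigenvalues k * z k ^ 2)
      (fun _ => P) (Measure.pi fun _ => gaussianReal 0 1)
    ∧
    -- consistency of the plug-in estimator of the covariance matrix
    (ContinuousWithinAt
        (fun t : EuclideanSpace ℝ (Fin m) × Table R S × Table R S =>
          limitCov G u V t.1 t.2.1 t.2.2)
        (Θ ×ˢ posCopulaPmf R S ×ˢ posPmf R S) (θ₀, ipfpUnif p, p) →
      ∀ a b, TendstoInMeasure P
        (fun (n : ℕ) ω => limitCov G u V (θhat n (sample XY n ω))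
          (empCopula (sample XY n ω)) (smoothPmf (sample XY n ω)) a b)
        atTop (fun _ => limitCov G u V θ₀ (ipfpUnif p) p a b)) := by
  have hZ := bddInProb_empPmf hXY hindep hlaw
  have hV' := tendstoInMeasure_iff_tendsto_probFilter.1 hV
  have hT : BddInProb P fun n ω => √(n : ℝ) • (θhat n (sample XY n ω) - θ₀) :=
    bddInProb_of_linear_expansion (W := V θ₀ (ipfpUnif p) p)
      (X := fun n ω => √(n : ℝ) • (θhat n (sample XY n ω) - θ₀)) hZ hV'
  have hθ := tendsto_of_bddInProb_sqrt (Y := fun n ω => θhat n (sample XY n ω)) hT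
  refine ⟨?_, fun hcont a b => ?_⟩
  · exact tendstoInDistribution_chiSquareStat hXY hindep hlaw (v := fun n x => u (θhat n x))
      (hu θ₀ hθ₀).1 ((hasFDerivAt_vec_family hdiff).continuousAt.tendsto.comp hθ)
      (tendsto_empCopula_sub_family (T := fun n ω => θhat n (sample XY n ω)) hp hZ hH₀ hdiff hT
        hV') hG _ (limitCov_eq G u V θ₀ _ p)
  · refine tendstoInMeasure_iff_tendsto_probFilter.2 ?_
    -- The plug-in arguments lie in the domain for every sample, so continuity relative to that
    -- domain suffices.
    have hmem : Tendsto (fun z : ℕ × Ω => (θhat z.1 (sample XY z.1 z.2),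
        empCopula (sample XY z.1 z.2), smoothPmf (sample XY z.1 z.2))) (probFilter P)
        (𝓝[Θ ×ˢ posCopulaPmf R S ×ˢ posPmf R S] (θ₀, ipfpUnif p, p)) :=
      tendsto_nhdsWithin_iff.2 ⟨hθ.prodMk_nhds
        ((tendsto_empCopula_ipfpUnif hp hZ).prodMk_nhds (tendsto_smoothPmf hZ)),
        Eventually.of_forall fun z => ⟨hθhat _ _,
          (ipfpUnif_spec (smoothPmf_mem_posPmf _)).1, smoothPmf_mem_posPmf _⟩⟩
    exact tendsto_pi_nhds.1 (tendsto_pi_nhds.1 (hcont.tendsto.comp hmem) a) b
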